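/- **Setting.** Consider a nonstationary $K$-armed bandit with $K\ge 1$ arms, horizon $T\ge 2$ and mean rewards $\mu_t(a)\in[0,1]$, for $t\in\{1,\dots,T\}$ and $a\in[K]$, and assume $K\le cT$ for a constant $c$. If arm $a_t$ is pulled in round $t$, the learner observes $r_t=\mu_t(a_t)+\xi_t(a_t)$, where the noise vectors $\xi_t=(\xi_t(a))_{a\in[K]}$, $t\ge1$, are independent and every $\xi_t(a)$ is zero-mean and $1$-sub-Gaussian, i.e. $\mathbb E\,e^{\lambda \xi_t(a)}\le e^{\lambda^2/2}$ for all $\lambda\in\mathbb R$ (nothing is assumed about the dependence between the coordinates of one $\xi_t$; in particular the noise may be the same for all arms). Let $$L:=1+\#\{1\le j<T:\ \mu_j(a)\ne\mu_{j+1}(a)\text{ for some }a\}$$ be the number of stationary segments, and let $1=T_0<T_1<\dots<T_L=T+1$ be the change points, so that the means are constant on each segment $\{T_\ell,\dots,T_{\ell+1}-1\}$. Put $\mu_{a,\ell}:=\mu_{T_\ell}(a)$ and $\mu^*_\ell:=\max_a\mu_{a,\ell}$. For a threshold $S\in\mathbb R$ put $\Delta_{a,\ell}:=(S-\mu_{a,\ell})_+$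 and $\Delta^*_\ell:=\mu^*_\ell-S$. The satisficing regret of a policy is $R_T^S:=\mathbb E\big[\sum_{t=1}^T(S-\mu_t(a_t))_+\big]$. **Algorithm (Nonstationary–Sat).** For $w\ge 1$ let $\beta(w):=\sqrt{2(4\log T+\log K)/w}$. For a nonempty buffer $\mathcal B$ (a finite list of rewards) of length $m$, let $w$ range over the powers of two $1,2,4,\dots$ that are at most $m$, let $\mathrm{Avg}(\mathcal B,w)$ be the average of the last $w$ entries, and put $$\mathrm{LCB}(\mathcal B):=\max_w\{\mathrm{Avg}(\mathcal B,w)-\beta(w)\},\qquad \mathrm{UCB}(\mathcal B):=\min_w\{\mathrm{Avg}(\mathcal B,w)+\beta(w)\}.$$ Every arm $a$ has a buffer $\mathcal B_a$, initially empty, and initially there is no leader. In each round $t=1,\dots,T$: - If there is no leader, pull the next arm $a_t$ in a fixed cyclic (round-robin) order of $[K]$ and append $r_t$ to $\mathcal B_{a_t}$. If then $\mathrm{LCB}(\mathcal B_{a_t})\ge S$, make $a_t$ the leader and empty $\mathcal B_{a_t}$. - If there is a leader, pull it as $a_t$ and append $r_t$ to $\mathcal B_{a_t}$. If then $\mathrm{UCB}(\mathcal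 B_{a_t})<S$, empty $\mathcal B_{a_t}$ and continue without a leader. The position in the round-robin order is kept while there is a leader. **Theorem.** For every constant $c$ there is a constant $C>0$, depending only on $c$, such that the following holds for all $K$, $T$, $S$, $(\mu_t)$ and $(\xi_t)$ as above and every round-robin order. If the problem is realizable, i.e. $\mu^*_\ell>S$ for every $\ell\in\{0,\dots,L-1\}$, then the satisficing regret of Nonstationary–Sat satisfies $$R_T^S\ \le\ C\sum_{\ell=0}^{L-1}\ \sum_{a:\ \mu_{a,\ell}<S}\Big(\frac1{\Delta_{a,\ell}}+\frac{\Delta_{a,\ell}}{(\Delta^*_\ell)^2}\Big)\log T .$$ -/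

import Mathlib

open MeasureTheory ProbabilityTheory

noncomputable section

namespace SatBandit

/-! ### The environment

Rounds are numbered `1, …, T`, the arms are the elements of `Fin K`, and `μ t a` is the mean reward
of arm `a` in round `t`. -/

/-- The number `L[s,t]` of stationary segments on the rounds `s, …, t`. -/
def numSegmentsOn {K : ℕ} (μ : ℕ → Fin K → ℝ) (s t : ℕ) : ℕ :=
  1 + ((Finset.Ico s t).filter (fun j => ∃ a, μ j a ≠ μ (j + 1) a)).card

/-- The total number `L = L[1,T]` of stationary segments. -/
def numSegments {K : ℕ} (μ : ℕ → Fin K → ℝ) (T : ℕ) : ℕ := numSegmentsOn μ 1 T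

/-- `t` is the first round of a stationary segment, or is `T + 1`. -/
def IsChangePoint {K : ℕ} (μ : ℕ → Fin K → ℝ) (T t : ℕ) : Prop :=
  t = 1 ∨ t = T + 1 ∨ (2 ≤ t ∧ t ≤ T ∧ ∃ a, μ (t - 1) a ≠ μ t a)

/-- The change points `1 = T_0 < T_1 < ⋯ < T_L = T + 1`, in increasing order; segment `l < L`
consists of the rounds `T_l, …, T_{l+1} - 1`. -/
def changePoint {K : ℕ} (μ : ℕ → Fin K → ℝ) (T l : ℕ) : ℕ := Nat.nth (IsChangePoint μ T) l

/-- The mean `μ_{a,l}` of arm `a` on segment `l`. -/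
def segMean {K : ℕ} (μ : ℕ → Fin K → ℝ) (T l : ℕ) (a : Fin K) : ℝ := μ (changePoint μ T l) a

/-- The largest mean `μ*_l` on segment `l`. -/
def bestMean {K : ℕ} (μ : ℕ → Fin K → ℝ) (T l : ℕ) : ℝ := ⨆ a, segMean μ T l a

/-- `Δ_{a,l} = (S - μ_{a,l})₊`. -/
def gap {K : ℕ} (S : ℝ) (μ : ℕ → Fin K → ℝ) (T l : ℕ) (a : Fin K) : ℝ :=
  max 0 (S - segMean μ T l a)

/-- `Δ*_l = μ*_l - S`. -/
def bestGap {K : ℕ} (S : ℝ) (μ : ℕ → Fin K → ℝ) (T l : ℕ) : ℝ := bestMean μ T l - S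

/-- Realizability: on every segment some arm has mean strictly above the threshold. -/
def Realizable {K : ℕ} (S : ℝ) (μ : ℕ → Fin K → ℝ) (T : ℕ) : Prop :=
  ∀ l < numSegments μ T, S < bestMean μ T l

/-- The noise: `ξ t ω a` is added to the mean if arm `a` is pulled in round `t`. The noise vectors
of different rounds are independent, and each entry is zero-mean and `1`-sub-Gaussian. Nothing is
assumed about the entries of one vector; noise that does not depend on the arm is the case
`ξ t ω a = ξ' t ω`. -/
structure IsNoise {K : ℕ} {Ω : Type*} [MeasurableSpace Ω] (P : Measure Ω)
    (ξ : ℕ → Ω → Fin K → ℝ) : Prop where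
  measurable : ∀ t, Measurable (ξ t)
  indep : iIndepFun ξ P
  mean_zero : ∀ t a, ∫ ω, ξ t ω a ∂P = 0
  subGaussian : ∀ t a, HasSubgaussianMGF (fun ω => ξ t ω a) 1 P

/-! ### Interaction of a policy with the environment -/

/-- A non-randomized policy chooses the next arm from the past (arm, reward) pairs, listed from the
first round to the last. -/
abbrev Policy (K : ℕ) : Type := List (Fin K × ℝ) → Fin K

/-- The history `(a_1, r_1), …, (a_t, r_t)` of the first `t` rounds, where
`r_t = μ t a_t + ξ t a_t`. -/
def history {K : ℕ} {Ω : Type*} (π : Policy K) (μ : ℕ → Fin K → ℝ) (ξ : ℕ → Ω → Fin K → ℝ)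
    (ω : Ω) : ℕ → List (Fin K × ℝ)
  | 0 => []
  | t + 1 =>
    let h := history π μ ξ ω t
    h ++ [(π h, μ (t + 1) (π h) + ξ (t + 1) ω (π h))]

/-- The arm `a_t` pulled in round `t ≥ 1`. -/
def action {K : ℕ} {Ω : Type*} (π : Policy K) (μ : ℕ → Fin K → ℝ) (ξ : ℕ → Ω → Fin K → ℝ)
    (t : ℕ) (ω : Ω) : Fin K :=
  π (history π μ ξ ω (t - 1))

/-- The realized cumulative shortfall `∑_{t=1}^T (S - μ_t(a_t))₊`. -/
def shortfall {K : ℕ} {Ω : Type*} (S : ℝ) (T : ℕ) (π : Policy K) (μ : ℕ → Fin K → ℝ)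
    (ξ : ℕ → Ω → Fin K → ℝ) (ω : Ω) : ℝ :=
  ∑ t ∈ Finset.Icc 1 T, max 0 (S - μ t (action π μ ξ t ω))

/-- The satisficing regret. -/
def regret {K : ℕ} {Ω : Type*} [MeasurableSpace Ω] (P : Measure Ω) (S : ℝ) (T : ℕ)
    (π : Policy K) (μ : ℕ → Fin K → ℝ) (ξ : ℕ → Ω → Fin K → ℝ) : ℝ :=
  ∫ ω, shortfall S T π μ ξ ω ∂P

/-! ### Windowed statistics; buffers are listed from the oldest entry to the newest -/

/-- The dyadic window lengths `2 ^ k ≤ m`, for a buffer of length `m` (`k < m` is automatic). -/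
def winSet (m : ℕ) : Finset ℕ :=
  ((Finset.range m).image (fun k => 2 ^ k)).filter (fun w => w ≤ m)

/-- The average of the last `w` entries of a buffer. -/
def avgLast (B : List ℝ) (w : ℕ) : ℝ := (B.drop (B.length - w)).sum / w

/-- The windowed lower confidence bound: a maximum over all windows (`⊥` for an empty buffer). -/
def lcbWin (β : ℕ → ℝ) (B : List ℝ) : EReal :=
  (winSet B.length).sup (fun w => ((avgLast B w - β w : ℝ) : EReal))

/-- The windowed upper confidence bound: a minimum over all windows (`⊤` for an empty buffer). -/
def ucbWin (β : ℕ → ℝ) (B : List ℝ) : EReal :=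
  (winSet B.length).inf (fun w => ((avgLast B w + β w : ℝ) : EReal))

/-- The confidence radius `β(w) = √(2 (4 log T + log K) / w)`. -/
def radius (K T : ℕ) (w : ℕ) : ℝ :=
  Real.sqrt (2 * (4 * Real.log T + Real.log K) / w)

/-! ### The algorithm Nonstationary–Sat -/

/-- The state of the algorithm: the leader, the buffer of the current epoch of each arm (buffers of
past epochs are never read again, so they are not kept), and the number of round-robin pulls made
so far. -/
structure State (K : ℕ) where
  leader : Option (Fin K)
  buffer : Fin K → List ℝ
  explored : ℕ

/-- Initially there is no leader and all buffers are empty. -/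
def State.init (K : ℕ) : State K := ⟨none, fun _ => [], 0⟩

/-- The arm pulled next: the leader, or, if there is none, the next arm in the fixed round-robin
order `order 0, order 1, …, order (K - 1), order 0, …`. -/
def State.arm {K : ℕ} [NeZero K] (order : Equiv.Perm (Fin K)) (st : State K) : Fin K :=
  match st.leader with
  | none => order (Fin.ofNat K st.explored)
  | some a => a

/-- One round: the new reward `r` is appended to the buffer `B` of the pulled arm. While exploring,
the arm is promoted if `LCB(B) ≥ S`; otherwise the leader is demoted if `UCB(B) < S`. Promotion and
demotion start a new epoch of the arm, with an empty buffer. -/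
def State.step {K : ℕ} [NeZero K] (S : ℝ) (β : ℕ → ℝ) (order : Equiv.Perm (Fin K))
    (st : State K) (r : ℝ) : State K :=
  let a := st.arm order
  let B := st.buffer a ++ [r]
  open Classical in
  match st.leader with
  | none =>
    if (S : EReal) ≤ lcbWin β B then
      ⟨some a, Function.update st.buffer a [], st.explored + 1⟩
    else
      ⟨none, Function.update st.buffer a B, st.explored + 1⟩
  | some _ =>
    if ucbWin β B < (S : EReal) then
      ⟨none, Function.update st.buffer a [], st.explored⟩
    else
      ⟨some a, Function.update st.buffer a B, st.explored⟩

/-- The policy Nonstationary–Sat for horizon `T` and threshold `S`. -/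
def nonstationarySat (K T : ℕ) [NeZero K] (S : ℝ) (order : Equiv.Perm (Fin K)) : Policy K :=
  fun h => State.arm order
    (h.foldl (fun st p => State.step S (radius K T) order st p.2) (State.init K))

end SatBandit

end

noncomputable section

namespace SatBandit

/-! ### The run of the algorithm on a table of rewards -/

/-! On a good event, the windowed averages of each arm over pulls inside one stationary segment are
within `radius` of the segment mean. Given that event, each segment is analysed deterministically.

Old rewards may pollute a buffer at the start of a segment, but they sit at its front. The dyadic
windows include one that covers at least half of the pulls made inside the segment and nothing
older, so stale data cannot delay a decision for long. Stale data can still cause a wrong promotion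
or demotion, but that empties the buffer. Hence an arm below `S` leads in at most one run of rounds
per segment: once demoted, its buffer holds only rewards of this segment, and accuracy forbids a new
promotion. While it leads, `S` lies below its UCB, which caps the run at `O(log T / Δ²)` rounds
(`leads_le`). By the same argument with the roles exchanged, a best arm is explored `O(log T / Δ*²)`
times and, once promoted inside the segment, is never demoted in it (`explores_le`). The round-robin
counter is frozen while there is a leader, so exploration pulls of two arms differ by at most one
(`explores_le_explores_add_one`), and the bound for the best arm controls the exploration of every
bad arm. Multiplying both counts by `Δ` gives the two terms of the regret bound
(`segment_shortfall_le`).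

The good event is a union bound over arms, start rounds, end rounds, pull counts and signs. The arm
of a round is determined by earlier noise, so the exponential weight of the noise over the pulls of
one arm is a supermartingale (`lintegral_pullWeight_le_one`). Only one coordinate of each noise
vector enters, so dependence between arms is harmless. Failure has probability at most `2 / T` and
costs at most `T`, hence adds at most 2 to the regret (`regret_le_add_two`). -/

/-- A state of the algorithm in which the buffers hold the numbers of the rounds instead of the
rewards. -/
@[ext]
structure Trace (K : ℕ) where
  leader : Option (Fin K)
  buffer : Fin K → List ℕ
  explored : ℕ

/-- The state of the algorithm for the rewards `y t a`. -/
def Trace.realize {K : ℕ} (y : ℕ → Fin K → ℝ) (x : Trace K) : State K :=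
  ⟨x.leader, fun a => (x.buffer a).map (fun t => y t a), x.explored⟩

/-- The arm pulled next. -/
def Trace.arm {K : ℕ} [NeZero K] (order : Equiv.Perm (Fin K)) (x : Trace K) : Fin K :=
  match x.leader with
  | none => order (Fin.ofNat K x.explored)
  | some a => a

/-- Round `t` on the reward table `y`. -/
def Trace.step {K : ℕ} [NeZero K] (S : ℝ) (β : ℕ → ℝ) (order : Equiv.Perm (Fin K))
    (y : ℕ → Fin K → ℝ) (t : ℕ) (x : Trace K) : Trace K :=
  let a := x.arm order
  let B := x.buffer a ++ [t]
  open Classical in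
  match x.leader with
  | none =>
    if (S : EReal) ≤ lcbWin β (B.map (fun t => y t a)) then
      ⟨some a, Function.update x.buffer a [], x.explored + 1⟩
    else
      ⟨none, Function.update x.buffer a B, x.explored + 1⟩
  | some _ =>
    if ucbWin β (B.map (fun t => y t a)) < (S : EReal) then
      ⟨none, Function.update x.buffer a [], x.explored⟩
    else
      ⟨some a, Function.update x.buffer a B, x.explored⟩

/-- The trace after `t` rounds on the reward table `y`. -/
def run {K : ℕ} [NeZero K] (S : ℝ) (β : ℕ → ℝ) (order : Equiv.Perm (Fin K))
    (y : ℕ → Fin K → ℝ) : ℕ → Trace K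
  | 0 => ⟨none, fun _ => [], 0⟩
  | t + 1 => (run S β order y t).step S β order y (t + 1)

section Run

variable {K : ℕ} [NeZero K] (S : ℝ) (β : ℕ → ℝ) (order : Equiv.Perm (Fin K))

omit [NeZero K] in
theorem map_update_buffer (y : ℕ → Fin K → ℝ) (f : Fin K → List ℕ) (a : Fin K) (B : List ℕ) :
    (fun b => (Function.update f a B b).map (fun t => y t b)) =
      Function.update (fun b => (f b).map (fun t => y t b)) a (B.map (fun t => y t a)) := by
  funext b
  by_cases h : b = a
  · subst h; simp
  · simp [h]

theorem Trace.arm_realize (y : ℕ → Fin K → ℝ) (x : Trace K) :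
    (x.realize y).arm order = x.arm order := rfl

theorem Trace.realize_step (y : ℕ → Fin K → ℝ) (t : ℕ) (x : Trace K) :
    (x.step S β order y t).realize y =
      (x.realize y).step S β order (y t (x.arm order)) := by
  obtain ⟨_ | b, f, n⟩ := x
  · by_cases h : (S : EReal) ≤ lcbWin β ((f (order (Fin.ofNat K n)) ++ [t]).map
      (fun τ => y τ (order (Fin.ofNat K n))))
    · refine (congrArg (Trace.realize y) (if_pos h)).trans (Eq.trans ?_ (if_pos ?_).symm)
      · simp [Trace.realize, map_update_buffer, Trace.arm, State.arm]
      · rw [List.map_append] at h; exact h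
    · refine (congrArg (Trace.realize y) (if_neg h)).trans (Eq.trans ?_ (if_neg ?_).symm)
      · simp [Trace.realize, map_update_buffer, Trace.arm, State.arm]
      · rw [List.map_append] at h; exact h
  · by_cases h : ucbWin β ((f b ++ [t]).map (fun τ => y τ b)) < (S : EReal)
    · refine (congrArg (Trace.realize y) (if_pos h)).trans (Eq.trans ?_ (if_pos ?_).symm)
      · simp [Trace.realize, map_update_buffer, Trace.arm, State.arm]
      · rw [List.map_append] at h; exact h
    · refine (congrArg (Trace.realize y) (if_neg h)).trans (Eq.trans ?_ (if_neg ?_).symm)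
      · simp [Trace.realize, map_update_buffer, Trace.arm, State.arm]
      · rw [List.map_append] at h; exact h

/-- The policy reads only rewards of pulled entries, so it can be simulated on the full table of
rewards. Buffers of round numbers then show which noise variables enter each statistic. -/
theorem foldl_history {Ω : Type*} (T : ℕ) (μ : ℕ → Fin K → ℝ) (ξ : ℕ → Ω → Fin K → ℝ)
    (ω : Ω) (t : ℕ) :
    (history (nonstationarySat K T S order) μ ξ ω t).foldl
        (fun st p => State.step S (radius K T) order st p.2) (State.init K) =
      (run S (radius K T) order (fun τ a => μ τ a + ξ τ ω a) t).realize
        (fun τ a => μ τ a + ξ τ ω a) := by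
  induction t with
  | zero => rfl
  | succ t ih =>
    have harm : nonstationarySat K T S order
        (history (nonstationarySat K T S order) μ ξ ω t) =
        (run S (radius K T) order (fun τ a => μ τ a + ξ τ ω a) t).arm order := by
      rw [← Trace.arm_realize order (fun τ a => μ τ a + ξ τ ω a), ← ih]
      rfl
    rw [history, List.foldl_append, ih, run, Trace.realize_step, List.foldl_cons, List.foldl_nil,
      harm]

theorem action_succ {Ω : Type*} (T : ℕ) (μ : ℕ → Fin K → ℝ) (ξ : ℕ → Ω → Fin K → ℝ)
    (ω : Ω) (t : ℕ) :
    action (nonstationarySat K T S order) μ ξ (t + 1) ω =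
      (run S (radius K T) order (fun τ a => μ τ a + ξ τ ω a) t).arm order := by
  rw [← Trace.arm_realize order (fun τ a => μ τ a + ξ τ ω a), ← foldl_history]
  rfl

theorem Trace.arm_of_leader {x : Trace K} {a : Fin K} (h : x.leader = some a) :
    x.arm order = a := by
  simp [Trace.arm, h]

theorem Trace.step_cases (y : ℕ → Fin K → ℝ) (t : ℕ) (x : Trace K) :
    (x.leader = none ∧
      (S : EReal) ≤ lcbWin β ((x.buffer (x.arm order) ++ [t]).map (fun τ => y τ (x.arm order))) ∧
      x.step S β order y t =
        ⟨some (x.arm order), Function.update x.buffer (x.arm order) [], x.explored + 1⟩) ∨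
    (x.leader = none ∧
      lcbWin β ((x.buffer (x.arm order) ++ [t]).map (fun τ => y τ (x.arm order))) < (S : EReal) ∧
      x.step S β order y t =
        ⟨none, Function.update x.buffer (x.arm order) (x.buffer (x.arm order) ++ [t]),
          x.explored + 1⟩) ∨
    (x.leader = some (x.arm order) ∧
      ucbWin β ((x.buffer (x.arm order) ++ [t]).map (fun τ => y τ (x.arm order))) < (S : EReal) ∧
      x.step S β order y t =
        ⟨none, Function.update x.buffer (x.arm order) [], x.explored⟩) ∨
    (x.leader = some (x.arm order) ∧
      (S : EReal) ≤ ucbWin β ((x.buffer (x.arm order) ++ [t]).map (fun τ => y τ (x.arm order))) ∧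
      x.step S β order y t =
        ⟨some (x.arm order), Function.update x.buffer (x.arm order)
          (x.buffer (x.arm order) ++ [t]), x.explored⟩) := by
  obtain ⟨_ | b, f, n⟩ := x
  · by_cases h : (S : EReal) ≤ lcbWin β ((f (order (Fin.ofNat K n)) ++ [t]).map
      (fun τ => y τ (order (Fin.ofNat K n))))
    · exact Or.inl ⟨rfl, h, if_pos h⟩
    · exact Or.inr (Or.inl ⟨rfl, not_le.1 h, if_neg h⟩)
  · by_cases h : ucbWin β ((f b ++ [t]).map (fun τ => y τ b)) < (S : EReal)
    · exact Or.inr (Or.inr (Or.inl ⟨rfl, h, if_pos h⟩))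
    · exact Or.inr (Or.inr (Or.inr ⟨rfl, not_lt.1 h, if_neg h⟩))

end Run

/-! ### Windowed statistics -/

theorem mem_winSet_pow {k m : ℕ} (h : 2 ^ k ≤ m) : 2 ^ k ∈ winSet m := by
  simp only [winSet, Finset.mem_filter, Finset.mem_image, Finset.mem_range]
  exact ⟨⟨k, lt_of_lt_of_le Nat.lt_two_pow_self h, rfl⟩, h⟩

theorem one_le_of_mem_winSet {m w : ℕ} (h : w ∈ winSet m) : 1 ≤ w := by
  simp only [winSet, Finset.mem_filter, Finset.mem_image, Finset.mem_range] at h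
  obtain ⟨⟨k, -, rfl⟩, -⟩ := h
  exact Nat.one_le_two_pow

theorem le_of_mem_winSet {m w : ℕ} (h : w ∈ winSet m) : w ≤ m :=
  (Finset.mem_filter.1 h).2

theorem le_lcbWin_iff {β : ℕ → ℝ} {B : List ℝ} {S : ℝ} :
    (S : EReal) ≤ lcbWin β B ↔ ∃ w ∈ winSet B.length, S ≤ avgLast B w - β w := by
  rw [lcbWin, Finset.le_sup_iff (EReal.bot_lt_coe S)]
  simp only [EReal.coe_le_coe_iff]

theorem ucbWin_lt_iff {β : ℕ → ℝ} {B : List ℝ} {S : ℝ} :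
    ucbWin β B < (S : EReal) ↔ ∃ w ∈ winSet B.length, avgLast B w + β w < S := by
  rw [ucbWin, Finset.inf_lt_iff]
  simp only [EReal.coe_lt_coe_iff]

/-- A short window does not see the older part of the buffer; this is how stale rewards are ignored.
-/
theorem avgLast_of_suffix {L B : List ℝ} (h : L <:+ B) {w : ℕ} (hw : w ≤ L.length) :
    avgLast B w = avgLast L w := by
  obtain ⟨A, rfl⟩ := h
  have : (A ++ L).length - w = A.length + (L.length - w) := by
    rw [List.length_append]; omega
  rw [avgLast, avgLast, this, ← List.drop_drop, List.drop_left]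

/-- The largest power of two below `n` loses at most a factor 2, so dyadic windows suffice. -/
theorem exists_winSet_double (n : ℕ) (hn : 1 ≤ n) :
    ∃ w, w ≤ n ∧ n ≤ 2 * w ∧ 1 ≤ w ∧ ∀ m, n ≤ m → w ∈ winSet m := by
  have h1 : 2 ^ Nat.log 2 n ≤ n := Nat.pow_log_le_self 2 (by omega)
  have h2 : n < 2 ^ (Nat.log 2 n + 1) := Nat.lt_pow_succ_log_self (by norm_num) n
  rw [pow_succ] at h2
  exact ⟨_, h1, by omega, Nat.one_le_two_pow, fun m hm => mem_winSet_pow (h1.trans hm)⟩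

/-! ### The rounds in which an arm is pulled -/

/-- The rounds in `{u + 1, …, t}` in which the arm sequence `α` (`α τ` is the arm of round `τ + 1`)
pulls the arm `a`. -/
def pulls {K : ℕ} (α : ℕ → Fin K) (a : Fin K) (u : ℕ) : ℕ → List ℕ
  | 0 => []
  | t + 1 => if u ≤ t ∧ α t = a then pulls α a u t ++ [t + 1] else pulls α a u t

section Pulls

variable {K : ℕ} (α : ℕ → Fin K) (a : Fin K)

theorem pulls_eq_nil {u t : ℕ} (h : t ≤ u) : pulls α a u t = [] := by
  induction t with
  | zero => rfl
  | succ t ih => rw [pulls, if_neg (by omega), ih (by omega)]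

theorem pulls_succ_of_eq {u t : ℕ} (h : u ≤ t) (ha : α t = a) :
    pulls α a u (t + 1) = pulls α a u t ++ [t + 1] := by
  rw [pulls, if_pos ⟨h, ha⟩]

theorem pulls_succ_of_ne {u t : ℕ} (ha : α t ≠ a) :
    pulls α a u (t + 1) = pulls α a u t := by
  rw [pulls, if_neg (fun h => ha h.2)]

theorem mem_pulls {u t τ : ℕ} (h : τ ∈ pulls α a u t) : u < τ ∧ τ ≤ t := by
  induction t with
  | zero => simp [pulls] at h
  | succ t ih =>
    rw [pulls] at h
    split_ifs at h with h'
    · rcases List.mem_append.1 h with h | h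
      · have := ih h; omega
      · rw [List.mem_singleton] at h; omega
    · have := ih h; omega

theorem length_pulls_le (u t : ℕ) : (pulls α a u t).length ≤ t := by
  induction t with
  | zero => simp [pulls]
  | succ t ih =>
    rw [pulls]
    split_ifs
    · simpa using ih
    · omega

/-- The last few pulls are all the pulls since some later round. Windows of random position thus
become pulls between two deterministic rounds, over which a union bound can be taken. -/
theorem exists_pulls_of_suffix {u t : ℕ} (hut : u ≤ t) {L : List ℕ} (h : L <:+ pulls α a u t) :
    ∃ u', u ≤ u' ∧ u' ≤ t ∧ L = pulls α a u' t := by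
  induction t generalizing L with
  | zero => exact ⟨u, le_rfl, hut, by simpa [pulls] using h⟩
  | succ t ih =>
    rcases Nat.lt_or_ge t u with hlt | hge
    · rw [pulls_eq_nil α a (by omega)] at h
      exact ⟨u, le_rfl, hut, by rw [pulls_eq_nil α a (by omega)]; simpa using h⟩
    · by_cases ha : α t = a
      · rw [pulls_succ_of_eq α a hge ha] at h
        rcases List.suffix_concat_iff.1 h with rfl | ⟨L', rfl, hL'⟩
        · exact ⟨t + 1, by omega, le_rfl, by rw [pulls_eq_nil α a le_rfl]⟩
        · obtain ⟨u', h1, h2, rfl⟩ := ih hge hL'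
          exact ⟨u', h1, by omega, (pulls_succ_of_eq α a h2 ha).symm⟩
      · rw [pulls_succ_of_ne α a ha] at h
        obtain ⟨u', h1, h2, rfl⟩ := ih hge h
        exact ⟨u', h1, by omega, (pulls_succ_of_ne α a ha).symm⟩

end Pulls

/-! ### The deterministic analysis of a stationary segment -/

/-- In the rounds `s + 1, …, e`, all windowed averages of the pulls of an arm are within the
confidence radius of its mean `m a`. -/
def Accurate {K : ℕ} (β : ℕ → ℝ) (m : Fin K → ℝ) (y : ℕ → Fin K → ℝ) (α : ℕ → Fin K)
    (s e : ℕ) : Prop :=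
  ∀ a u t, s ≤ u → u ≤ t → t ≤ e → ∀ w, 1 ≤ w → w ≤ (pulls α a u t).length →
    |avgLast ((pulls α a u t).map (fun τ => y τ a)) w - m a| ≤ β w

theorem accurate_of_noise {K : ℕ} {β : ℕ → ℝ} {m : Fin K → ℝ} {z y : ℕ → Fin K → ℝ}
    {α : ℕ → Fin K} {s e : ℕ} (hy : ∀ τ a, s < τ → τ ≤ e → y τ a = m a + z τ a)
    (hz : ∀ a u t, u ≤ t → t ≤ e →
      |((pulls α a u t).map (fun τ => z τ a)).sum| ≤
        (pulls α a u t).length * β (pulls α a u t).length) :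
    Accurate β m y α s e := by
  intro a u t hsu hut hte w hw1 hw
  obtain ⟨u', h1, h2, h3⟩ := exists_pulls_of_suffix α a hut
    (List.drop_suffix ((pulls α a u t).length - w) (pulls α a u t))
  have hlen : (pulls α a u' t).length = w := by
    rw [← h3, List.length_drop]; omega
  have hsum : ((pulls α a u' t).map (fun τ => y τ a)).sum =
      w * m a + ((pulls α a u' t).map (fun τ => z τ a)).sum := by
    have : (pulls α a u' t).map (fun τ => y τ a) =
        (pulls α a u' t).map (fun τ => m a + z τ a) := by
      refine List.map_congr_left fun τ hτ => ?_
      have := mem_pulls α a hτ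
      exact hy τ a (by omega) (by omega)
    rw [this, List.sum_map_add, List.map_const', List.sum_replicate, hlen, nsmul_eq_mul]
  have hw0 : (0 : ℝ) < w := by exact_mod_cast hw1
  have hz' := hz a u' t h2 hte
  rw [hlen] at hz'
  rw [avgLast, List.length_map, ← List.map_drop, h3, hsum]
  have : (w * m a + ((pulls α a u' t).map (fun τ => z τ a)).sum) / w - m a =
      ((pulls α a u' t).map (fun τ => z τ a)).sum / w := by
    field_simp; ring
  rw [this, abs_div, abs_of_pos hw0, div_le_iff₀ hw0]
  linarith

/-- The number of rounds in `{s + 1, …, t}` in which arm `a` is pulled as the leader. -/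
def leads {K : ℕ} (x : ℕ → Trace K) (a : Fin K) (s t : ℕ) : ℕ :=
  ∑ τ ∈ Finset.Ico s t, if (x τ).leader = some a then 1 else 0

/-- The number of rounds in `{s + 1, …, t}` in which arm `a` is pulled without a leader. -/
def explores {K : ℕ} [NeZero K] (order : Equiv.Perm (Fin K)) (x : ℕ → Trace K) (a : Fin K)
    (s t : ℕ) : ℕ :=
  ∑ τ ∈ Finset.Ico s t, if (x τ).leader = none ∧ (x τ).arm order = a then 1 else 0

section Segment

variable {K T : ℕ}

/-- Squaring gives `w ≤ 8 (4 log T + log K) / δ²`; the dyadic rounding `n ≤ 2 * w` doubles the 8. -/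
theorem le_of_half_le_radius {n w : ℕ} {δ : ℝ} (hδ : 0 < δ) (hw : 1 ≤ w) (hn : n ≤ 2 * w)
    (h : δ / 2 ≤ radius K T w) :
    (n : ℝ) ≤ 16 * (4 * Real.log T + Real.log K) / δ ^ 2 := by
  have hw0 : (0 : ℝ) < w := by exact_mod_cast hw
  have hn' : (n : ℝ) ≤ 2 * w := by exact_mod_cast hn
  have h1 : (δ / 2) ^ 2 ≤ 2 * (4 * Real.log T + Real.log K) / w :=
    (Real.le_sqrt' (by positivity)).1 h
  rw [le_div_iff₀ hw0] at h1
  rw [le_div_iff₀ (by positivity)]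
  nlinarith [sq_nonneg δ, mul_le_mul_of_nonneg_right hn' (sq_nonneg δ)]

variable [NeZero K] {S : ℝ} {order : Equiv.Perm (Fin K)} {y : ℕ → Fin K → ℝ}
  {m : Fin K → ℝ} {s e : ℕ}

omit [NeZero K] in
theorem leads_succ (x : ℕ → Trace K) (a : Fin K) {s t : ℕ} (h : s ≤ t) :
    leads x a s (t + 1) = leads x a s t + if (x t).leader = some a then 1 else 0 :=
  Finset.sum_Ico_succ_top h _

theorem explores_succ (x : ℕ → Trace K) (a : Fin K) {s t : ℕ} (h : s ≤ t) :
    explores order x a s (t + 1) = explores order x a s t +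
      if (x t).leader = none ∧ (x t).arm order = a then 1 else 0 :=
  Finset.sum_Ico_succ_top h _

/-- An arm below the threshold leads for `O(log T / Δ²)` rounds of a stationary segment. -/
theorem leads_le
    (hacc : Accurate (radius K T) m y
      (fun τ => (run S (radius K T) order y τ).arm order) s e)
    {a : Fin K} (ha : m a < S) {t : ℕ} (hst : s ≤ t) (hte : t ≤ e) :
    (leads (run S (radius K T) order y) a s t : ℝ) ≤
      16 * (4 * Real.log T + Real.log K) / (S - m a) ^ 2 + 1 := by
  set x := run S (radius K T) order y with hx
  set α : ℕ → Fin K := fun τ => (x τ).arm order with hα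
  set n : ℝ := 16 * (4 * Real.log T + Real.log K) / (S - m a) ^ 2 with hn
  have hn0 : 0 ≤ n := by
    have h1 : 0 ≤ Real.log T := Real.log_natCast_nonneg T
    have h2 : 0 ≤ Real.log K := Real.log_natCast_nonneg K
    positivity
  -- Three phases: the arm has not yet led in this segment (its buffer is arbitrary); it leads, and
  -- its buffer ends with all its leader pulls of this segment; it has been demoted, and its buffer
  -- is purely from this segment. The last phase is never left, and the round of the demotion costs
  -- the extra 1.
  have key : ((x t).leader ≠ some a ∧ leads x a s t = 0) ∨
      ((x t).leader = some a ∧ (leads x a s t : ℝ) ≤ n ∧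
        ∃ u, s ≤ u ∧ u ≤ t ∧ pulls α a u t <:+ (x t).buffer a ∧
          (pulls α a u t).length = leads x a s t) ∨
      ((x t).leader ≠ some a ∧ (leads x a s t : ℝ) ≤ n + 1 ∧
        ∃ u, s ≤ u ∧ u ≤ t ∧ (x t).buffer a = pulls α a u t) := by
    induction t, hst using Nat.le_induction with
    | base =>
      have h0 : leads x a s s = 0 := by simp [leads]
      by_cases hl : (x s).leader = some a
      · refine Or.inr (Or.inl ⟨hl, by rw [h0]; simpa using hn0, s, le_rfl, le_rfl, ?_, ?_⟩)
        · rw [pulls_eq_nil α a le_rfl]; exact List.nil_suffix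
        · rw [pulls_eq_nil α a le_rfl, h0]; rfl
      · exact Or.inl ⟨hl, h0⟩
    | succ t hst ih =>
      have ih := ih (by omega)
      have hstep : x (t + 1) = (x t).step S (radius K T) order y (t + 1) := rfl
      rw [leads_succ x a hst]
      by_cases hl : (x t).leader = some a
      · rw [if_pos hl]
        have harm : (x t).arm order = a := Trace.arm_of_leader order hl
        rcases ih with h | ⟨-, h1, u, hsu, hut, hsuf, hlen⟩ | h
        · exact absurd hl h.1
        · have hp : pulls α a u (t + 1) = pulls α a u t ++ [t + 1] :=
            pulls_succ_of_eq α a hut harm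
          have hsuf' : pulls α a u (t + 1) <:+ (x t).buffer a ++ [t + 1] := by
            rw [hp]
            obtain ⟨A, hA⟩ := hsuf
            exact ⟨A, by rw [← hA, List.append_assoc]⟩
          have hlen' : (pulls α a u (t + 1)).length = leads x a s t + 1 := by
            rw [hp, List.length_append, hlen]; rfl
          rcases (x t).step_cases S (radius K T) order y (t + 1) with h | h | ⟨-, -, h⟩ | ⟨-, h3, h⟩
          · rw [h.1] at hl; exact absurd hl (by simp)
          · rw [h.1] at hl; exact absurd hl (by simp)
          · right; right
            rw [hstep, h, harm]
            refine ⟨by simp, by push_cast; linarith, t + 1, by omega, le_rfl, ?_⟩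
            rw [pulls_eq_nil α a le_rfl]; simp
          · right; left
            rw [hstep, h]
            refine ⟨by simp [harm], ?_, u, hsu, by omega, by simpa [harm] using hsuf', hlen'⟩
            rw [harm] at h3
            -- No demotion means that no window has its UCB below `S`. For a window inside the
            -- segment this gives `S ≤ m a + 2 β(w)`.
            obtain ⟨w, hw1, hw2, hw3, hw4⟩ := exists_winSet_double (leads x a s t + 1) (by omega)
            have h4 : ¬ _ := fun h5 => (not_lt.2 h3) (ucbWin_lt_iff.2 h5)
            push Not at h4
            have hle := hsuf'.length_le
            rw [hlen'] at hle
            have h5 := h4 w (hw4 _ (by simpa using hle))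
            rw [avgLast_of_suffix (hsuf'.map _) (by rw [List.length_map, hlen']; exact hw1)] at h5
            have h6 := abs_le.1 (hacc a u (t + 1) hsu (by omega) hte w hw3
              (by rw [hlen']; exact hw1))
            exact le_of_half_le_radius (by linarith) hw3 hw2 (by linarith [h6.2])
        · exact absurd hl h.1
      · rw [if_neg hl, add_zero]
        rcases (x t).step_cases S (radius K T) order y (t + 1) with
          ⟨-, h3, h⟩ | ⟨-, -, h⟩ | ⟨h2, -, h⟩ | ⟨h2, -, h⟩
        · by_cases harm : (x t).arm order = a
          · rcases ih with ⟨-, h1⟩ | h | ⟨-, -, u, hsu, hut, hbuf⟩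
            · right; left
              rw [hstep, h, h1, harm]
              refine ⟨rfl, by simpa using hn0, t + 1, by omega, le_rfl, ?_, ?_⟩
              · rw [pulls_eq_nil α a le_rfl]; exact List.nil_suffix
              · rw [pulls_eq_nil α a le_rfl]; rfl
            · exact absurd h.1 hl
            -- A promotion after a demotion would need `S ≤ avg - β(w) ≤ m a`, on rewards of this
            -- segment only.
            · exfalso
              rw [harm, hbuf, ← pulls_succ_of_eq α a hut harm, le_lcbWin_iff] at h3
              obtain ⟨w, hw, h3⟩ := h3
              have hwl := le_of_mem_winSet hw
              rw [List.length_map] at hwl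
              have h6 := abs_le.1 (hacc a u (t + 1) hsu (by omega) hte w
                (one_le_of_mem_winSet hw) hwl)
              linarith [h6.2]
          · rcases ih with ⟨-, h1⟩ | h | ⟨-, h1, u, hsu, hut, hbuf⟩
            · left
              rw [hstep, h]
              exact ⟨by simpa using harm, h1⟩
            · exact absurd h.1 hl
            · right; right
              rw [hstep, h]
              refine ⟨by simpa using harm, h1, u, hsu, by omega, ?_⟩
              rw [pulls_succ_of_ne α a harm, ← hbuf]
              simp [Ne.symm harm]
        · rcases ih with ⟨-, h1⟩ | h | ⟨-, h1, u, hsu, hut, hbuf⟩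
          · left
            rw [hstep, h]
            exact ⟨by simp, h1⟩
          · exact absurd h.1 hl
          · right; right
            rw [hstep, h]
            refine ⟨by simp, h1, u, hsu, by omega, ?_⟩
            by_cases harm : (x t).arm order = a
            · rw [pulls_succ_of_eq α a hut harm, harm, ← hbuf]; simp
            · rw [pulls_succ_of_ne α a harm, ← hbuf]; simp [Ne.symm harm]
        · have harm : (x t).arm order ≠ a := fun h => hl (by rw [h2, h])
          rcases ih with ⟨-, h1⟩ | h | ⟨-, h1, u, hsu, hut, hbuf⟩
          · left
            rw [hstep, h]
            exact ⟨by simp, h1⟩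
          · exact absurd h.1 hl
          · right; right
            rw [hstep, h]
            refine ⟨by simp, h1, u, hsu, by omega, ?_⟩
            rw [pulls_succ_of_ne α a harm, ← hbuf]; simp [Ne.symm harm]
        · have harm : (x t).arm order ≠ a := fun h => hl (by rw [h2, h])
          rcases ih with ⟨-, h1⟩ | h | ⟨-, h1, u, hsu, hut, hbuf⟩
          · left
            rw [hstep, h]
            exact ⟨by simpa using harm, h1⟩
          · exact absurd h.1 hl
          · right; right
            rw [hstep, h]
            refine ⟨by simpa using harm, h1, u, hsu, by omega, ?_⟩
            rw [pulls_succ_of_ne α a harm, ← hbuf]; simp [Ne.symm harm]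
  rcases key with ⟨-, h⟩ | ⟨-, h, -⟩ | ⟨-, h, -⟩
  · rw [h]; push_cast; linarith
  · linarith
  · exact h

/-- An arm above the threshold is explored for `O(log T / Δ²)` rounds of a stationary segment. -/
theorem explores_le
    (hacc : Accurate (radius K T) m y
      (fun τ => (run S (radius K T) order y τ).arm order) s e)
    {a : Fin K} (ha : S < m a) {t : ℕ} (hst : s ≤ t) (hte : t ≤ e) :
    (explores order (run S (radius K T) order y) a s t : ℝ) ≤
      16 * (4 * Real.log T + Real.log K) / (m a - S) ^ 2 + 1 := by
  set x := run S (radius K T) order y with hx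
  set α : ℕ → Fin K := fun τ => (x τ).arm order with hα
  set n : ℝ := 16 * (4 * Real.log T + Real.log K) / (m a - S) ^ 2 with hn
  have hn0 : 0 ≤ n := by
    have h1 : 0 ≤ Real.log T := Real.log_natCast_nonneg T
    have h2 : 0 ≤ Real.log K := Real.log_natCast_nonneg K
    positivity
  -- The phases of `leads_le` with leading and exploring exchanged: leader since the start of the
  -- segment; not the leader, with all exploration pulls of the segment at the end of the buffer;
  -- promoted with a fresh buffer, which accuracy makes permanent.
  have key : ((x t).leader = some a ∧ explores order x a s t = 0) ∨
      ((x t).leader ≠ some a ∧ (explores order x a s t : ℝ) ≤ n ∧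
        ∃ u, s ≤ u ∧ u ≤ t ∧ pulls α a u t <:+ (x t).buffer a ∧
          explores order x a s t = (pulls α a u t).length) ∨
      ((x t).leader = some a ∧ (explores order x a s t : ℝ) ≤ n + 1 ∧
        ∃ u, s ≤ u ∧ u ≤ t ∧ (x t).buffer a = pulls α a u t) := by
    induction t, hst using Nat.le_induction with
    | base =>
      have h0 : explores order x a s s = 0 := by simp [explores]
      by_cases hl : (x s).leader = some a
      · exact Or.inl ⟨hl, h0⟩
      · refine Or.inr (Or.inl ⟨hl, by rw [h0]; simpa using hn0, s, le_rfl, le_rfl, ?_, ?_⟩)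
        · rw [pulls_eq_nil α a le_rfl]; exact List.nil_suffix
        · rw [pulls_eq_nil α a le_rfl, h0]; rfl
    | succ t hst ih =>
      have ih := ih (by omega)
      have hstep : x (t + 1) = (x t).step S (radius K T) order y (t + 1) := rfl
      rw [explores_succ x a hst]
      by_cases hl : (x t).leader = some a
      · rw [if_neg (by simp [hl]), add_zero]
        have harm : (x t).arm order = a := Trace.arm_of_leader order hl
        rcases (x t).step_cases S (radius K T) order y (t + 1) with
          h | h | ⟨-, h3, h⟩ | ⟨-, -, h⟩
        · rw [h.1] at hl; exact absurd hl (by simp)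
        · rw [h.1] at hl; exact absurd hl (by simp)
        · rcases ih with ⟨-, h1⟩ | h | ⟨-, -, u, hsu, hut, hbuf⟩
          · right; left
            rw [hstep, h, h1, harm]
            refine ⟨by simp, by simpa using hn0, t + 1, by omega, le_rfl, ?_, ?_⟩
            · rw [pulls_eq_nil α a le_rfl]; exact List.nil_suffix
            · rw [pulls_eq_nil α a le_rfl]; rfl
          · exact absurd hl h.1
          · exfalso
            rw [harm, hbuf, ← pulls_succ_of_eq α a hut harm, ucbWin_lt_iff] at h3
            obtain ⟨w, hw, h3⟩ := h3
            have hwl := le_of_mem_winSet hw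
            rw [List.length_map] at hwl
            have h6 := abs_le.1 (hacc a u (t + 1) hsu (by omega) hte w
              (one_le_of_mem_winSet hw) hwl)
            linarith [h6.1]
        · rcases ih with ⟨-, h1⟩ | h | ⟨-, h1, u, hsu, hut, hbuf⟩
          · left
            rw [hstep, h, harm]
            exact ⟨rfl, h1⟩
          · exact absurd hl h.1
          · right; right
            rw [hstep, h, harm]
            refine ⟨rfl, h1, u, hsu, by omega, ?_⟩
            rw [pulls_succ_of_eq α a hut harm, ← hbuf]; simp
      · rcases ih with h | ⟨-, h1, u, hsu, hut, hsuf, hlen⟩ | h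
        · exact absurd h.1 hl
        · by_cases harm : (x t).arm order = a
          · have hl0 : (x t).leader = none := by
              rcases (x t).step_cases S (radius K T) order y (t + 1) with h | h | h | h
              · exact h.1
              · exact h.1
              · exact absurd (h.1.trans (by rw [harm])) hl
              · exact absurd (h.1.trans (by rw [harm])) hl
            rw [if_pos ⟨hl0, harm⟩]
            have hp : pulls α a u (t + 1) = pulls α a u t ++ [t + 1] :=
              pulls_succ_of_eq α a hut harm
            have hsuf' : pulls α a u (t + 1) <:+ (x t).buffer a ++ [t + 1] := by
              rw [hp]
              obtain ⟨A, hA⟩ := hsuf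
              exact ⟨A, by rw [← hA, List.append_assoc]⟩
            have hlen' : (pulls α a u (t + 1)).length = explores order x a s t + 1 := by
              rw [hp, List.length_append, hlen]; rfl
            rcases (x t).step_cases S (radius K T) order y (t + 1) with
              ⟨-, -, h⟩ | ⟨-, h3, h⟩ | h | h
            · right; right
              rw [hstep, h, harm]
              refine ⟨rfl, by push_cast; linarith, t + 1, by omega, le_rfl, ?_⟩
              rw [pulls_eq_nil α a le_rfl]; simp
            · right; left
              rw [hstep, h]
              refine ⟨by simp, ?_, u, hsu, by omega, by simpa [harm] using hsuf', hlen'.symm⟩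
              rw [harm] at h3
              obtain ⟨w, hw1, hw2, hw3, hw4⟩ :=
                exists_winSet_double (explores order x a s t + 1) (by omega)
              have h4 : ¬ _ := fun h5 => (not_le.2 h3) (le_lcbWin_iff.2 h5)
              push Not at h4
              have hle := hsuf'.length_le
              rw [hlen'] at hle
              have h5 := h4 w (hw4 _ (by simpa using hle))
              rw [avgLast_of_suffix (hsuf'.map _) (by rw [List.length_map, hlen']; exact hw1)] at h5
              have h6 := abs_le.1 (hacc a u (t + 1) hsu (by omega) hte w hw3
                (by rw [hlen']; exact hw1))
              exact le_of_half_le_radius (by linarith) hw3 hw2 (by linarith [h6.1])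
            · rw [hl0] at h; exact absurd h.1 (by simp)
            · rw [hl0] at h; exact absurd h.1 (by simp)
          · rw [if_neg (fun h => harm h.2), add_zero]
            right; left
            have hbuf : (x (t + 1)).buffer a = (x t).buffer a := by
              rw [hstep]
              rcases (x t).step_cases S (radius K T) order y (t + 1) with
                ⟨-, -, h⟩ | ⟨-, -, h⟩ | ⟨-, -, h⟩ | ⟨-, -, h⟩ <;> rw [h] <;> simp [Ne.symm harm]
            have hlead : (x (t + 1)).leader ≠ some a := by
              rw [hstep]
              rcases (x t).step_cases S (radius K T) order y (t + 1) with
                ⟨-, -, h⟩ | ⟨-, -, h⟩ | ⟨-, -, h⟩ | ⟨-, -, h⟩ <;> rw [h] <;> simp [harm]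
            exact ⟨hlead, h1, u, hsu, by omega,
              by rw [hbuf, pulls_succ_of_ne α a harm]; exact hsuf,
              by rw [pulls_succ_of_ne α a harm]; exact hlen⟩
        · exact absurd h.1 hl
  rcases key with ⟨-, h⟩ | ⟨-, h, -⟩ | ⟨-, h, -⟩
  · rw [h]; push_cast; linarith
  · linarith
  · exact h

/-- The counter advances exactly in the rounds without a leader, and its residue modulo `K` selects
the arm. -/
theorem explores_eq_card (a : Fin K) {t : ℕ} (hst : s ≤ t) :
    (run S (radius K T) order y s).explored ≤ (run S (radius K T) order y t).explored ∧
    explores order (run S (radius K T) order y) a s t =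
      ((Finset.Ico (run S (radius K T) order y s).explored
        (run S (radius K T) order y t).explored).filter
          (fun j => j ≡ (order.symm a : ℕ) [MOD K])).card := by
  set x := run S (radius K T) order y with hx
  induction t, hst using Nat.le_induction with
  | base => simp [explores]
  | succ t hst ih =>
    obtain ⟨ih1, ih2⟩ := ih
    have hstep : x (t + 1) = (x t).step S (radius K T) order y (t + 1) := rfl
    rw [explores_succ x a hst]
    by_cases hl : (x t).leader = none
    · have he : (x (t + 1)).explored = (x t).explored + 1 := by
        rw [hstep]
        rcases (x t).step_cases S (radius K T) order y (t + 1) with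
          ⟨-, -, h⟩ | ⟨-, -, h⟩ | ⟨h2, -, h⟩ | ⟨h2, -, h⟩
        · rw [h]
        · rw [h]
        · rw [hl] at h2; exact absurd h2 (by simp)
        · rw [hl] at h2; exact absurd h2 (by simp)
      refine ⟨by omega, ?_⟩
      have harm : (x t).arm order = a ↔ (x t).explored ≡ (order.symm a : ℕ) [MOD K] := by
        have h1 : (x t).arm order = order (Fin.ofNat K (x t).explored) := by
          simp [Trace.arm, hl]
        rw [h1, ← Equiv.eq_symm_apply, Fin.ext_iff, Fin.val_ofNat, Nat.ModEq,
          Nat.mod_eq_of_lt (order.symm a).isLt]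
      rw [he, ← Finset.insert_Ico_right_eq_Ico_add_one ih1, Finset.filter_insert, ih2]
      by_cases h : (x t).explored ≡ (order.symm a : ℕ) [MOD K]
      · rw [if_pos h, if_pos ⟨hl, harm.2 h⟩, Finset.card_insert_of_notMem (by simp)]
      · rw [if_neg h, if_neg (fun h' => h (harm.1 h'.2)), add_zero]
    · have he : (x (t + 1)).explored = (x t).explored := by
        rw [hstep]
        rcases (x t).step_cases S (radius K T) order y (t + 1) with
          h | h | ⟨-, -, h⟩ | ⟨-, -, h⟩
        · exact absurd h.1 hl
        · exact absurd h.1 hl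
        · rw [h]
        · rw [h]
      rw [he, if_neg (fun h => hl h.1), add_zero]
      exact ⟨ih1, ih2⟩

/-- In the round-robin order, the numbers of exploration pulls of two arms differ by at most one. -/
theorem explores_le_explores_add_one (a b : Fin K) {t : ℕ} (hst : s ≤ t) :
    explores order (run S (radius K T) order y) a s t ≤
      explores order (run S (radius K T) order y) b s t + 1 := by
  obtain ⟨h0, ha⟩ := explores_eq_card (S := S) (T := T) (order := order) (y := y) a hst
  obtain ⟨-, hb⟩ := explores_eq_card (S := S) (T := T) (order := order) (y := y) b hst
  rw [ha, hb]
  set E := (run S (radius K T) order y s).explored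
  set F := (run S (radius K T) order y t).explored
  have hK : 0 < K := Nat.pos_of_ne_zero (NeZero.ne K)
  have hK' : (0 : ℚ) < K := by exact_mod_cast hK
  have hE : (E : ℚ) ≤ F := by exact_mod_cast h0
  have A := Nat.Ico_filter_modEq_card E F hK (order.symm a : ℕ)
  have B := Nat.Ico_filter_modEq_card E F hK (order.symm b : ℕ)
  have e1 : ∀ v : ℚ, ((F : ℚ) - v) / K - ((E : ℚ) - v) / K = ((F : ℚ) - E) / K := by
    intro v; field_simp; ring
  set p := order.symm a
  set q := order.symm b
  have a1 := Int.ceil_lt_add_one (((F : ℚ) - (p : ℕ)) / K)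
  have a2 := Int.le_ceil (((E : ℚ) - (p : ℕ)) / K)
  have b1 := Int.ceil_lt_add_one (((E : ℚ) - (q : ℕ)) / K)
  have b2 := Int.le_ceil (((F : ℚ) - (q : ℕ)) / K)
  have ea := e1 (p : ℕ)
  have eb := e1 (q : ℕ)
  -- Either count is less than 1 away from `(F - E) / K`, so the two differ by less than 2, hence by
  -- at most 1 as integers.
  have hlt : ((⌈((F : ℚ) - (p : ℕ)) / K⌉ - ⌈((E : ℚ) - (p : ℕ)) / K⌉ : ℤ) : ℚ) <
      ((⌈((F : ℚ) - (q : ℕ)) / K⌉ - ⌈((E : ℚ) - (q : ℕ)) / K⌉ + 2 : ℤ) : ℚ) := by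
    push_cast; linarith
  have hlt' := Int.cast_lt.1 hlt
  omega

/-- The shortfall on a stationary segment. -/
theorem segment_shortfall_le
    (hacc : Accurate (radius K T) m y
      (fun τ => (run S (radius K T) order y τ).arm order) s e)
    (hse : s ≤ e) {b : Fin K} (hb : S < m b) :
    ∑ τ ∈ Finset.Ico s e, max 0 (S - m ((run S (radius K T) order y τ).arm order)) ≤
      ∑ a ∈ Finset.univ.filter (fun a => m a < S),
        (16 * (4 * Real.log T + Real.log K) *
          (1 / (S - m a) + (S - m a) / (m b - S) ^ 2) + 3 * (S - m a)) := by
  set x := run S (radius K T) order y with hx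
  -- Each round is charged to its arm, either as a leader round or as an exploration round.
  have hpt : ∀ τ, max 0 (S - m ((x τ).arm order)) =
      ∑ a, (((if (x τ).leader = some a then 1 else 0 : ℕ) : ℝ) +
        ((if (x τ).leader = none ∧ (x τ).arm order = a then 1 else 0 : ℕ) : ℝ)) *
          max 0 (S - m a) := by
    intro τ
    rw [Finset.sum_eq_single ((x τ).arm order)]
    · rcases h : (x τ).leader with _ | c
      · simp
      · simp [Trace.arm_of_leader order h]
    · intro a _ ha
      have h1 : (x τ).leader ≠ some a := fun h => ha (Trace.arm_of_leader order h).symm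
      simp [h1, Ne.symm ha]
    · simp
  rw [Finset.sum_congr rfl (fun τ _ => hpt τ), Finset.sum_comm, Finset.sum_filter]
  refine Finset.sum_le_sum fun a _ => ?_
  rw [← Finset.sum_mul, Finset.sum_add_distrib, ← Nat.cast_sum, ← Nat.cast_sum]
  split_ifs with ha
  · have hδ : 0 < S - m a := by linarith
    rw [max_eq_right hδ.le]
    have h1 := leads_le hacc ha hse le_rfl
    have h2 := explores_le hacc hb hse le_rfl
    have h3 : (explores order x a s e : ℝ) ≤ explores order x b s e + 1 := by
      exact_mod_cast explores_le_explores_add_one a b hse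
    rw [leads] at h1
    rw [explores] at h3
    -- The 3 in the bound collects 1 from the demotion of `a`, 1 from the promotion of `b` and 1
    -- from the round-robin comparison.
    have h4 := mul_le_mul_of_nonneg_right (add_le_add h1 (h3.trans (add_le_add_left h2 1))) hδ.le
    refine h4.trans (le_of_eq ?_)
    have hδ' : 0 < m b - S := by linarith
    field_simp
    ring
  · rw [max_eq_left (by linarith), mul_zero]

end Segment

/-! ### The segments -/

section Segments

variable {K : ℕ} (μ : ℕ → Fin K → ℝ) {T : ℕ}

open Classical in
theorem count_isChangePoint (hT : 1 ≤ T) :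
    Nat.count (IsChangePoint μ T) (T + 1) = numSegments μ T := by
  rw [Nat.count_eq_card_filter_range, numSegments, numSegmentsOn]
  have : (Finset.range (T + 1)).filter (IsChangePoint μ T) =
      insert 1 (((Finset.Ico 1 T).filter (fun j => ∃ a, μ j a ≠ μ (j + 1) a)).image (· + 1)) := by
    ext t
    simp only [Finset.mem_filter, Finset.mem_range, IsChangePoint, Finset.mem_insert,
      Finset.mem_image, Finset.mem_Ico]
    constructor
    · rintro ⟨h1, h2 | h2 | ⟨h2, h3, h4⟩⟩
      · exact Or.inl h2
      · omega
      · refine Or.inr ⟨t - 1, ⟨⟨by omega, by omega⟩, ?_⟩, by omega⟩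
        rwa [Nat.sub_add_cancel (by omega)]
    · rintro (h | ⟨j, ⟨⟨h1, h2⟩, h3⟩, rfl⟩)
      · exact ⟨by omega, Or.inl h⟩
      · exact ⟨by omega, Or.inr (Or.inr ⟨by omega, by omega, by simpa using h3⟩)⟩
  rw [this, Finset.card_insert_of_notMem, Finset.card_image_of_injective _ (add_left_injective 1),
    add_comm]
  simp

theorem changePoint_numSegments (hT : 1 ≤ T) : changePoint μ T (numSegments μ T) = T + 1 := by
  classical
  rw [changePoint, ← count_isChangePoint μ hT]
  exact Nat.nth_count (Or.inr (Or.inl rfl))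

theorem changePoint_zero : changePoint μ T 0 = 1 := by
  classical
  have h0 : ¬ IsChangePoint μ T 0 := by
    simp [IsChangePoint]
  have h : Nat.count (IsChangePoint μ T) 1 = 0 := by
    rw [Nat.count_succ, Nat.count_zero, if_neg h0]
  rw [changePoint, ← h]
  exact Nat.nth_count (Or.inl rfl)

theorem changePoint_mono (hT : 1 ≤ T) {k l : ℕ} (hkl : k ≤ l) (hl : l ≤ numSegments μ T) :
    changePoint μ T k ≤ changePoint μ T l := by
  -- There are finitely many change points, and `Nat.nth` is 0 past the last one. As 0 is no change
  -- point and the value at `numSegments μ T` is `T + 1`, no index up to there takes the default.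
  refine Nat.nth_le_nth' hkl fun hf => Nat.lt_card_toFinset_of_nth_ne_zero ?_ hf
  refine Nat.nth_ne_zero_anti (by simp [IsChangePoint]) hl ?_
  change changePoint μ T _ ≠ 0
  rw [changePoint_numSegments μ hT]
  omega

theorem eq_segMean (hT : 1 ≤ T) {l : ℕ} (hl : l < numSegments μ T) {t : ℕ}
    (h1 : changePoint μ T l ≤ t) (h2 : t < changePoint μ T (l + 1)) :
    μ t = segMean μ T l := by
  induction t, h1 using Nat.le_induction with
  | base => rfl
  | succ t ht ih =>
    rw [← ih (by omega)]
    by_contra hne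
    have h3 : IsChangePoint μ T (t + 1) := by
      have hpos := changePoint_mono μ hT (Nat.zero_le l) hl.le
      have hle := changePoint_mono μ hT (show l + 1 ≤ _ from hl) le_rfl
      rw [changePoint_zero μ] at hpos
      rw [changePoint_numSegments μ hT] at hle
      refine Or.inr (Or.inr ⟨by omega, by omega, ?_⟩)
      rw [Nat.add_sub_cancel]
      by_contra hall
      push Not at hall
      exact hne (funext fun a => (hall a).symm)
    have := Nat.le_nth_of_lt_nth_succ h2 h3
    change t + 1 ≤ changePoint μ T l at this
    omega

theorem sum_rounds_eq_sum_segments (hT : 1 ≤ T) (f : ℕ → ℝ) :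
    ∑ t ∈ Finset.Icc 1 T, f t = ∑ l ∈ Finset.range (numSegments μ T),
      ∑ t ∈ Finset.Ico (changePoint μ T l) (changePoint μ T (l + 1)), f t := by
  have h : ∀ n ≤ numSegments μ T, ∑ t ∈ Finset.Ico 1 (changePoint μ T n), f t =
      ∑ l ∈ Finset.range n,
        ∑ t ∈ Finset.Ico (changePoint μ T l) (changePoint μ T (l + 1)), f t := by
    intro n
    induction n with
    | zero => simp [changePoint_zero μ]
    | succ n ih =>
      intro hn
      have h1 := changePoint_mono μ hT (Nat.zero_le n) (by omega)
      rw [changePoint_zero μ] at h1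
      rw [Finset.sum_range_succ, ← ih (by omega),
        Finset.sum_Ico_consecutive _ h1 (changePoint_mono μ hT (Nat.le_succ n) hn)]
  rw [← h _ le_rfl, changePoint_numSegments μ hT]
  rfl

end Segments

/-- The noise of all windows of pulls is within the confidence radius. -/
def WellConcentrated {K : ℕ} (T : ℕ) (α : ℕ → Fin K) (z : ℕ → Fin K → ℝ) : Prop :=
  ∀ a u t, u ≤ t → t ≤ T → |((pulls α a u t).map (fun τ => z τ a)).sum| ≤
    (pulls α a u t).length * radius K T (pulls α a u t).length

/-- The shortfall of a run in which the noise is well concentrated. -/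
theorem run_shortfall_le {K T : ℕ} [NeZero K] (hT : 1 ≤ T) {S : ℝ} {order : Equiv.Perm (Fin K)}
    {μ : ℕ → Fin K → ℝ} (hS : Realizable S μ T) {z : ℕ → Fin K → ℝ}
    (hz : WellConcentrated T
      (fun τ => (run S (radius K T) order (fun t a => μ t a + z t a) τ).arm order) z) :
    ∑ t ∈ Finset.Icc 1 T, max 0 (S - μ t ((run S (radius K T) order
        (fun t a => μ t a + z t a) (t - 1)).arm order)) ≤
      ∑ l ∈ Finset.range (numSegments μ T),
        ∑ a ∈ Finset.univ.filter (fun a => segMean μ T l a < S),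
          (16 * (4 * Real.log T + Real.log K) *
            (1 / gap S μ T l a + gap S μ T l a / (bestGap S μ T l) ^ 2) +
              3 * gap S μ T l a) := by
  rw [sum_rounds_eq_sum_segments μ hT]
  refine Finset.sum_le_sum fun l hl => ?_
  rw [Finset.mem_range] at hl
  have hpos := changePoint_mono μ hT (Nat.zero_le l) hl.le
  have hlast := changePoint_mono μ hT (show l + 1 ≤ _ from hl) le_rfl
  have hmono := changePoint_mono μ hT (Nat.le_succ l) hl
  rw [changePoint_zero μ] at hpos
  rw [changePoint_numSegments μ hT] at hlast
  -- Shift by one: the trace after `τ` rounds determines the arm of round `τ + 1`.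
  obtain ⟨s, hs⟩ : ∃ s, changePoint μ T l = s + 1 := ⟨_, (Nat.sub_add_cancel hpos).symm⟩
  obtain ⟨e, he⟩ : ∃ e, changePoint μ T (l + 1) = e + 1 :=
    ⟨_, (Nat.sub_add_cancel (hpos.trans hmono)).symm⟩
  have hm : ∀ τ, s < τ → τ ≤ e → μ τ = segMean μ T l := fun τ h1 h2 =>
    eq_segMean μ hT hl (by omega) (by omega)
  have hse : s ≤ e := by
    have : changePoint μ T l ≤ changePoint μ T (l + 1) := hmono
    omega
  have heT : e ≤ T := by
    have : changePoint μ T (l + 1) ≤ T + 1 := hlast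
    omega
  have hacc : Accurate (radius K T) (segMean μ T l) (fun t a => μ t a + z t a)
      (fun τ => (run S (radius K T) order (fun t a => μ t a + z t a) τ).arm order) s e :=
    accurate_of_noise (z := z) (fun τ a h1 h2 => by simp only [hm τ h1 h2])
      fun a u t h1 h2 => hz a u t h1 (h2.trans heT)
  obtain ⟨b, hb⟩ := exists_eq_ciSup_of_finite (f := segMean μ T l)
  have hbS : S < segMean μ T l b := by rw [hb]; exact hS l hl
  have h := segment_shortfall_le hacc hse hbS
  rw [hs, he, ← Finset.sum_Ico_add' _ s e 1]
  have hbg : bestGap S μ T l = segMean μ T l b - S := by rw [hb]; rfl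
  rw [hbg]
  calc _ = ∑ τ ∈ Finset.Ico s e, max 0 (S - segMean μ T l ((run S (radius K T) order
        (fun t a => μ t a + z t a) τ).arm order)) := by
        refine Finset.sum_congr rfl fun τ hτ => ?_
        rw [Finset.mem_Ico] at hτ
        rw [hm (τ + 1) (by omega) (by omega), Nat.add_sub_cancel]
    _ ≤ _ := h
    _ = _ := by
        refine Finset.sum_congr rfl fun a ha => ?_
        have : gap S μ T l a = S - segMean μ T l a :=
          max_eq_right (by linarith [(Finset.mem_filter.1 ha).2])
        rw [this]

/-! ### Measurability of the run -/

section Measurability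

variable {K : ℕ}

/-- Traces store round numbers, not rewards, so they are countably many and measurability reduces to
that of the two threshold tests. -/
instance : MeasurableSpace (Trace K) := ⊤

instance : DiscreteMeasurableSpace (Trace K) := ⟨fun _ => trivial⟩

instance : Countable (Trace K) :=
  Function.Injective.countable
    (f := fun x : Trace K => (x.leader, x.buffer, x.explored)) fun x y h => by
      simp only [Prod.mk.injEq] at h
      exact Trace.ext h.1 h.2.1 h.2.2

theorem measurable_sum_map (L : List ℕ) (a : Fin K) :
    Measurable (fun y : ℕ → Fin K → ℝ => (L.map (fun τ => y τ a)).sum) := by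
  induction L with
  | nil => simp
  | cons τ L ih =>
    simp only [List.map_cons, List.sum_cons]
    exact Measurable.add (by fun_prop) ih

theorem measurable_avgLast_map (L : List ℕ) (a : Fin K) (w : ℕ) :
    Measurable (fun y : ℕ → Fin K → ℝ => avgLast (L.map (fun τ => y τ a)) w) := by
  simp only [avgLast, List.length_map, ← List.map_drop]
  exact (measurable_sum_map _ a).div_const _

theorem measurableSet_le_lcbWin (S : ℝ) (β : ℕ → ℝ) (L : List ℕ) (a : Fin K) :
    MeasurableSet {y : ℕ → Fin K → ℝ | (S : EReal) ≤ lcbWin β (L.map (fun τ => y τ a))} := by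
  have : {y : ℕ → Fin K → ℝ | (S : EReal) ≤ lcbWin β (L.map (fun τ => y τ a))} =
      ⋃ w ∈ winSet L.length, {y | S ≤ avgLast (L.map (fun τ => y τ a)) w - β w} := by
    ext y
    simp [le_lcbWin_iff]
  rw [this]
  exact Finset.measurableSet_biUnion _ fun w _ =>
    measurableSet_le measurable_const ((measurable_avgLast_map L a w).sub_const _)

theorem measurableSet_ucbWin_lt (S : ℝ) (β : ℕ → ℝ) (L : List ℕ) (a : Fin K) :
    MeasurableSet {y : ℕ → Fin K → ℝ | ucbWin β (L.map (fun τ => y τ a)) < (S : EReal)} := by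
  have : {y : ℕ → Fin K → ℝ | ucbWin β (L.map (fun τ => y τ a)) < (S : EReal)} =
      ⋃ w ∈ winSet L.length, {y | avgLast (L.map (fun τ => y τ a)) w + β w < S} := by
    ext y
    simp [ucbWin_lt_iff]
  rw [this]
  exact Finset.measurableSet_biUnion _ fun w _ =>
    measurableSet_lt ((measurable_avgLast_map L a w).add_const _) measurable_const

variable [NeZero K] (S : ℝ) (β : ℕ → ℝ) (order : Equiv.Perm (Fin K))

theorem Trace.measurable_step (t : ℕ) (x : Trace K) :
    Measurable (fun y : ℕ → Fin K → ℝ => x.step S β order y t) := by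
  obtain ⟨_ | b, f, n⟩ := x
  · exact Measurable.ite (measurableSet_le_lcbWin S β
      (f (order (Fin.ofNat K n)) ++ [t]) (order (Fin.ofNat K n))) measurable_const measurable_const
  · exact Measurable.ite (measurableSet_ucbWin_lt S β (f b ++ [t]) b)
      measurable_const measurable_const

theorem measurable_run (t : ℕ) :
    Measurable (fun y : ℕ → Fin K → ℝ => run S β order y t) := by
  induction t with
  | zero => exact measurable_const
  | succ t ih =>
    have h : Measurable (fun p : (ℕ → Fin K → ℝ) × Trace K => p.2.step S β order p.1 (t + 1)) :=
      measurable_from_prod_countable_left fun x => x.measurable_step S β order (t + 1)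
    exact h.comp (measurable_id.prodMk ih)

theorem measurable_run_arm (t : ℕ) :
    Measurable (fun y : ℕ → Fin K → ℝ => (run S β order y t).arm order) :=
  (measurable_of_countable (Trace.arm order)).comp (measurable_run S β order t)

variable {S β order}

theorem le_of_mem_buffer (y : ℕ → Fin K → ℝ) (t : ℕ) (a : Fin K) {τ : ℕ}
    (h : τ ∈ (run S β order y t).buffer a) : τ ≤ t := by
  induction t generalizing τ with
  | zero => simp [run] at h
  | succ t ih =>
    rw [run] at h
    by_cases ha : a = (run S β order y t).arm order
    · rcases (run S β order y t).step_cases S β order y (t + 1) with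
        ⟨-, -, h'⟩ | ⟨-, -, h'⟩ | ⟨-, -, h'⟩ | ⟨-, -, h'⟩
      all_goals
        rw [h', ← ha] at h
        simp only [Function.update_self, List.mem_append, List.mem_singleton, List.not_mem_nil] at h
      · rcases h with h | h
        · have := ih h; omega
        · omega
      · rcases h with h | h
        · have := ih h; omega
        · omega
    · have : τ ∈ (run S β order y t).buffer a := by
        rcases (run S β order y t).step_cases S β order y (t + 1) with
          ⟨-, -, h'⟩ | ⟨-, -, h'⟩ | ⟨-, -, h'⟩ | ⟨-, -, h'⟩
        all_goals
          rw [h'] at h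
          simpa [ha] using h
      have := ih this
      omega

/-- Buffers contain past rounds only; this makes the arm choice predictable. -/
theorem run_congr {y y' : ℕ → Fin K → ℝ} {t : ℕ} (h : ∀ τ ≤ t, y τ = y' τ) :
    run S β order y t = run S β order y' t := by
  induction t with
  | zero => rfl
  | succ t ih =>
    have ih := ih fun τ hτ => h τ (by omega)
    have hmap : ((run S β order y t).buffer ((run S β order y t).arm order) ++ [t + 1]).map
          (fun τ => y τ ((run S β order y t).arm order)) =
        ((run S β order y t).buffer ((run S β order y t).arm order) ++ [t + 1]).map
          (fun τ => y' τ ((run S β order y t).arm order)) := by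
      refine List.map_congr_left fun τ hτ => ?_
      rw [h τ]
      rcases List.mem_append.1 hτ with hτ | hτ
      · have := le_of_mem_buffer y t _ hτ
        omega
      · rw [List.mem_singleton] at hτ
        omega
    rw [run, run, ← ih]
    simp only [Trace.step]
    rw [hmap]

end Measurability

/-! ### Concentration of the noise over the pulls of an arm -/

/-- The exponential supermartingale of the noise over the pulls of arm `a` after round `u`. -/
def pullWeight {K : ℕ} (α : (ℕ → Fin K → ℝ) → ℕ → Fin K) (l : ℝ) (a : Fin K) (u : ℕ)
    (z : ℕ → Fin K → ℝ) : ℕ → ENNReal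
  | 0 => 1
  | t + 1 => pullWeight α l a u z t *
      if u ≤ t ∧ α z t = a then ENNReal.ofReal (Real.exp (l * z (t + 1) a - l ^ 2 / 2)) else 1

section Concentration

variable {K : ℕ} {α : (ℕ → Fin K → ℝ) → ℕ → Fin K} {Ω : Type*} [MeasurableSpace Ω]
  {P : Measure Ω} [IsProbabilityMeasure P] {ξ : ℕ → Ω → Fin K → ℝ}

theorem pullWeight_eq (l : ℝ) (a : Fin K) (u : ℕ) (z : ℕ → Fin K → ℝ) (t : ℕ) :
    pullWeight α l a u z t = ENNReal.ofReal (Real.exp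
      (l * ((pulls (α z) a u t).map (fun τ => z τ a)).sum -
        (pulls (α z) a u t).length * (l ^ 2 / 2))) := by
  induction t with
  | zero => simp [pullWeight, pulls]
  | succ t ih =>
    rw [pullWeight, ih, pulls]
    split_ifs
    · rw [← ENNReal.ofReal_mul (Real.exp_nonneg _), ← Real.exp_add]
      congr 2
      simp
      ring
    · rw [mul_one]

theorem measurable_pullWeight (hα : ∀ t, Measurable (fun z => α z t)) (l : ℝ) (a : Fin K)
    (u t : ℕ) : Measurable (fun z => pullWeight α l a u z t) := by
  induction t with
  | zero => exact measurable_const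
  | succ t ih =>
    refine ih.mul (Measurable.ite ?_ (by fun_prop) measurable_const)
    exact (MeasurableSet.const _).inter (hα t (measurableSet_singleton a))

theorem pullWeight_congr (hα : ∀ t z z', (∀ τ ≤ t, z τ = z' τ) → α z t = α z' t) (l : ℝ)
    (a : Fin K) (u t : ℕ) {z z' : ℕ → Fin K → ℝ} (h : ∀ τ ≤ t, z τ = z' τ) :
    pullWeight α l a u z t = pullWeight α l a u z' t := by
  induction t with
  | zero => rfl
  | succ t ih =>
    rw [pullWeight, pullWeight, ih fun τ hτ => h τ (by omega),
      hα t z z' fun τ hτ => h τ (by omega), h (t + 1) le_rfl]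

omit [IsProbabilityMeasure P] in
theorem indepFun_past (hξ : IsNoise P ξ) {t : ℕ} {F : (ℕ → Fin K → ℝ) → ENNReal}
    (hF : Measurable F) (hFt : ∀ z z', (∀ τ ≤ t, z τ = z' τ) → F z = F z') :
    IndepFun (fun ω => F (fun τ => ξ τ ω)) (ξ (t + 1)) P := by
  have hI := hξ.indep.indepFun_finset (Finset.range (t + 1)) {t + 1} (by simp) hξ.measurable
  -- Extending by zero turns a function of the whole table that ignores rounds after `t` into a
  -- function of finitely many coordinates.
  let ext : (Finset.range (t + 1) → Fin K → ℝ) → ℕ → Fin K → ℝ :=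
    fun v i => if h : i ∈ Finset.range (t + 1) then v ⟨i, h⟩ else 0
  have hext : Measurable ext := by
    refine measurable_pi_lambda _ fun i => ?_
    by_cases h : i ∈ Finset.range (t + 1)
    · simp only [ext, dif_pos h]; exact measurable_pi_apply _
    · simp only [ext, dif_neg h]; exact measurable_const
  have hc := hI.comp (hF.comp hext)
    (measurable_pi_apply (⟨t + 1, Finset.mem_singleton_self _⟩ : ({t + 1} : Finset ℕ)))
  convert hc using 1
  · funext ω
    refine hFt _ _ fun τ hτ => ?_
    have h : τ ∈ Finset.range (t + 1) := by rw [Finset.mem_range]; omega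
    simp only [ext, dif_pos h]
  · rfl

omit [IsProbabilityMeasure P] in
theorem lintegral_exp_noise_le (hξ : IsNoise P ξ) (l : ℝ) (t : ℕ) (a : Fin K) :
    ∫⁻ ω, ENNReal.ofReal (Real.exp (l * ξ t ω a - l ^ 2 / 2)) ∂P ≤ 1 := by
  have h := hξ.subGaussian t a
  simp only [sub_eq_add_neg, Real.exp_add]
  rw [← ofReal_integral_eq_lintegral_ofReal ((h.integrable_exp_mul l).mul_const _)
    (Filter.Eventually.of_forall fun ω => by positivity), integral_mul_const]
  have h1 := h.mgf_le l
  rw [mgf] at h1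
  refine ENNReal.ofReal_le_one.2 ?_
  calc _ ≤ Real.exp ((1 : NNReal) * l ^ 2 / 2) * Real.exp (-(l ^ 2 / 2)) :=
        mul_le_mul_of_nonneg_right h1 (Real.exp_nonneg _)
    _ = 1 := by rw [← Real.exp_add]; simp

theorem lintegral_pullWeight_le_one (hξ : IsNoise P ξ)
    (hα : ∀ t, Measurable (fun z => α z t))
    (hα' : ∀ t z z', (∀ τ ≤ t, z τ = z' τ) → α z t = α z' t) (l : ℝ) (a : Fin K) (u t : ℕ) :
    ∫⁻ ω, pullWeight α l a u (fun τ => ξ τ ω) t ∂P ≤ 1 := by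
  have hZ : Measurable (fun ω τ => ξ τ ω) := measurable_pi_lambda _ hξ.measurable
  induction t with
  | zero => simp [pullWeight]
  | succ t ih =>
    have hA : MeasurableSet {z | u ≤ t ∧ α z t = a} :=
      (MeasurableSet.const _).inter (hα t (measurableSet_singleton a))
    -- `F` is the weight where round `t + 1` counts and `F'` the weight elsewhere; only `F` gains a
    -- factor, which is independent of it and has mean at most 1.
    let F : (ℕ → Fin K → ℝ) → ENNReal :=
      fun z => if u ≤ t ∧ α z t = a then pullWeight α l a u z t else 0
    let F' : (ℕ → Fin K → ℝ) → ENNReal :=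
      fun z => if u ≤ t ∧ α z t = a then 0 else pullWeight α l a u z t
    have hF : Measurable F :=
      Measurable.ite hA (measurable_pullWeight hα l a u t) measurable_const
    have hF' : Measurable F' :=
      Measurable.ite hA measurable_const (measurable_pullWeight hα l a u t)
    have hFc : ∀ z z', (∀ τ ≤ t, z τ = z' τ) → F z = F z' := fun z z' h => by
      simp only [F, hα' t z z' h, pullWeight_congr hα' l a u t h]
    let g : (Fin K → ℝ) → ENNReal := fun v => ENNReal.ofReal (Real.exp (l * v a - l ^ 2 / 2))
    have hg : Measurable g := by fun_prop
    have hsplit : ∀ z, pullWeight α l a u z (t + 1) = F z * g (z (t + 1)) + F' z := fun z => by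
      simp only [pullWeight, F, F', g]
      split_ifs <;> simp
    have hsum : ∀ z, pullWeight α l a u z t = F z + F' z := fun z => by
      simp only [F, F']
      split_ifs <;> simp
    simp only [hsplit]
    simp only [hsum] at ih
    have hF'Z : Measurable (fun ω => F' (fun τ => ξ τ ω)) := hF'.comp hZ
    rw [lintegral_add_right _ hF'Z]
    rw [lintegral_add_right _ hF'Z] at ih
    refine le_trans (add_le_add_left ?_ _) ih
    have hI : IndepFun (fun ω => F (fun τ => ξ τ ω)) (fun ω => g (ξ (t + 1) ω)) P :=
      (indepFun_past hξ hF hFc).comp measurable_id hg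
    have := lintegral_mul_eq_lintegral_mul_lintegral_of_indepFun (hF.comp hZ)
      (hg.comp (hξ.measurable (t + 1))) hI
    simp only [Pi.mul_apply, Function.comp_apply] at this
    rw [this]
    exact mul_le_of_le_one_right' (lintegral_exp_noise_le hξ l (t + 1) a)

/-- Markov's inequality for the exponential weight at the optimal parameter `ε * b`, with `ε = ±1`
giving the two tails. The weight is then at least `exp (w * b² - w * b² / 2)`. -/
theorem measure_pulls_sum_ge_le (hξ : IsNoise P ξ)
    (hα : ∀ t, Measurable (fun z => α z t))
    (hα' : ∀ t z z', (∀ τ ≤ t, z τ = z' τ) → α z t = α z' t) (a : Fin K) (u t w : ℕ)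
    {b ε : ℝ} (hb : 0 ≤ b) (hε : ε ^ 2 = 1) :
    P {ω | (pulls (α (fun τ => ξ τ ω)) a u t).length = w ∧
      w * b ≤ ε * ((pulls (α (fun τ => ξ τ ω)) a u t).map (fun τ => ξ τ ω a)).sum} ≤
      ENNReal.ofReal (Real.exp (-(w * b ^ 2 / 2))) := by
  have hZ : Measurable (fun ω τ => ξ τ ω) := measurable_pi_lambda _ hξ.measurable
  have hpos : 0 < Real.exp (w * b ^ 2 / 2) := Real.exp_pos _
  calc _ ≤ P {ω | ENNReal.ofReal (Real.exp (w * b ^ 2 / 2)) ≤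
          pullWeight α (ε * b) a u (fun τ => ξ τ ω) t} := by
        refine measure_mono fun ω hω => ?_
        obtain ⟨h1, h2⟩ := hω
        rw [Set.mem_ofPred_eq, pullWeight_eq, h1]
        refine ENNReal.ofReal_le_ofReal (Real.exp_le_exp.2 ?_)
        have h3 := mul_le_mul_of_nonneg_right h2 hb
        rw [mul_pow, hε]
        linarith
    _ ≤ (∫⁻ ω, pullWeight α (ε * b) a u (fun τ => ξ τ ω) t ∂P) /
          ENNReal.ofReal (Real.exp (w * b ^ 2 / 2)) :=
        meas_ge_le_lintegral_div
          ((measurable_pullWeight hα (ε * b) a u t).comp hZ).aemeasurable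
          (by simpa using hpos) ENNReal.ofReal_ne_top
    _ ≤ 1 / ENNReal.ofReal (Real.exp (w * b ^ 2 / 2)) :=
        ENNReal.div_le_div_right (lintegral_pullWeight_le_one hξ hα hα' _ a u t) _
    _ = _ := by
        rw [one_div, ← ENNReal.ofReal_inv_of_pos hpos, Real.exp_neg]

/-- At most `2 K T³` events, each of probability at most `1 / (T⁴ K)` by the choice of `radius`. -/
theorem measure_not_wellConcentrated_le [NeZero K] {T : ℕ} (hT : 1 ≤ T) (hξ : IsNoise P ξ)
    (hα : ∀ t, Measurable (fun z => α z t))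
    (hα' : ∀ t z z', (∀ τ ≤ t, z τ = z' τ) → α z t = α z' t) :
    P {ω | ¬ WellConcentrated T (α (fun τ => ξ τ ω)) (fun τ => ξ τ ω)} ≤
      ENNReal.ofReal (2 / T) := by
  have hT0 : (0 : ℝ) < T := by exact_mod_cast hT
  have hK0 : (0 : ℝ) < K := by exact_mod_cast Nat.pos_of_ne_zero (NeZero.ne K)
  let I : Finset (Fin K × ℕ × ℕ × ℕ × ℝ) :=
    Finset.univ ×ˢ Finset.range T ×ˢ Finset.Icc 1 T ×ˢ Finset.Icc 1 T ×ˢ {1, -1}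
  let E : Fin K × ℕ × ℕ × ℕ × ℝ → Set Ω := fun i =>
    {ω | (pulls (α (fun τ => ξ τ ω)) i.1 i.2.1 i.2.2.1).length = i.2.2.2.1 ∧
      i.2.2.2.1 * radius K T i.2.2.2.1 ≤ i.2.2.2.2 *
        ((pulls (α (fun τ => ξ τ ω)) i.1 i.2.1 i.2.2.1).map (fun τ => ξ τ ω i.1)).sum}
  have hsub : {ω | ¬ WellConcentrated T (α (fun τ => ξ τ ω)) (fun τ => ξ τ ω)} ⊆
      ⋃ i ∈ I, E i := by
    intro ω hω
    simp only [Set.mem_ofPred_eq, WellConcentrated] at hω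
    push Not at hω
    obtain ⟨a, u, t, hut, htT, h⟩ := hω
    set L := pulls (α (fun τ => ξ τ ω)) a u t with hL
    have hlen : L.length ≠ 0 := by
      intro h0
      rw [List.length_eq_zero_iff.1 h0] at h
      simp at h
    have hlt : u < t := by
      by_contra hge
      exact hlen (by rw [hL, pulls_eq_nil _ a (not_lt.1 hge)]; rfl)
    have hle : L.length ≤ t := length_pulls_le _ a u t
    simp only [Set.mem_iUnion]
    rcases lt_abs.1 h with h | h
    · refine ⟨(a, u, t, L.length, 1), ?_, rfl, by simpa using h.le⟩
      simp only [I, Finset.mem_product, Finset.mem_univ, Finset.mem_range, Finset.mem_Icc,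
        Finset.mem_insert, Finset.mem_singleton]
      exact ⟨trivial, by omega, by omega, by omega, by simp⟩
    · refine ⟨(a, u, t, L.length, -1), ?_, rfl, by simpa using h.le⟩
      simp only [I, Finset.mem_product, Finset.mem_univ, Finset.mem_range, Finset.mem_Icc,
        Finset.mem_insert, Finset.mem_singleton]
      exact ⟨trivial, by omega, by omega, by omega, by simp⟩
  have hE : ∀ i ∈ I, P (E i) ≤ ENNReal.ofReal (1 / (T ^ 4 * K)) := by
    rintro ⟨a, u, t, w, ε⟩ hi
    simp only [I, Finset.mem_product, Finset.mem_univ, Finset.mem_range, Finset.mem_Icc,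
        Finset.mem_insert, Finset.mem_singleton] at hi
    obtain ⟨-, -, -, ⟨hw, -⟩, hε⟩ := hi
    have hw0 : (0 : ℝ) < w := by exact_mod_cast hw
    have hε' : ε ^ 2 = 1 := by rcases hε with rfl | rfl <;> norm_num
    refine (measure_pulls_sum_ge_le hξ hα hα' a u t w (Real.sqrt_nonneg _) hε').trans
      (ENNReal.ofReal_le_ofReal (le_of_eq ?_))
    have h1 : 0 ≤ Real.log T := Real.log_natCast_nonneg T
    have h2 : 0 ≤ Real.log K := Real.log_natCast_nonneg K
    rw [Real.sq_sqrt (by positivity)]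
    have h3 : (w : ℝ) * (2 * (4 * Real.log T + Real.log K) / w) / 2 =
        Real.log (T ^ 4 * K) := by
      rw [Real.log_mul (by positivity) (by positivity), Real.log_pow]
      field_simp
      push_cast
      ring
    rw [h3, Real.exp_neg, Real.exp_log (by positivity), one_div]
  have hcard : I.card = K * (T * (T * (T * 2))) := by
    simp only [I, Finset.card_product, Finset.card_univ, Fintype.card_fin, Finset.card_range,
      Nat.card_Icc, Nat.add_sub_cancel]
    rw [Finset.card_pair (by norm_num)]
  calc _ ≤ P (⋃ i ∈ I, E i) := measure_mono hsub
    _ ≤ ∑ i ∈ I, P (E i) := measure_biUnion_finset_le _ _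
    _ ≤ ∑ i ∈ I, ENNReal.ofReal (1 / (T ^ 4 * K)) := Finset.sum_le_sum hE
    _ = ENNReal.ofReal (2 / T) := by
        rw [Finset.sum_const, nsmul_eq_mul, hcard, ← ENNReal.ofReal_natCast,
          ← ENNReal.ofReal_mul (by positivity)]
        congr 1
        push_cast
        field_simp

end Concentration

/-! ### From the good event to the expected regret -/

section Regret

variable {K T : ℕ} {S : ℝ} {μ : ℕ → Fin K → ℝ}

theorem changePoint_mem_Icc (hT : 1 ≤ T) {l : ℕ} (hl : l < numSegments μ T) :
    changePoint μ T l ∈ Finset.Icc 1 T := by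
  classical
  have h1 := changePoint_mono μ hT (Nat.zero_le l) hl.le
  rw [changePoint_zero μ] at h1
  rw [← count_isChangePoint μ hT] at hl
  exact Finset.mem_Icc.2 ⟨h1, Nat.lt_succ_iff.1 (Nat.nth_lt_of_lt_count hl)⟩

theorem threshold_lt_one [NeZero K] (hT : 1 ≤ T)
    (hμ : ∀ t ∈ Finset.Icc 1 T, ∀ a, μ t a ∈ Set.Icc (0 : ℝ) 1) (hS : Realizable S μ T) :
    S < 1 := by
  have hl : 0 < numSegments μ T := by rw [numSegments, numSegmentsOn]; omega
  refine (hS 0 hl).trans_le (ciSup_le fun a => ?_)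
  exact (hμ _ (changePoint_mem_Icc hT hl) a).2

/-- The gaps are at most one, so the summands of the regret bound are at least one. -/
theorem one_le_inv_gap_add [NeZero K] (hT : 1 ≤ T)
    (hμ : ∀ t ∈ Finset.Icc 1 T, ∀ a, μ t a ∈ Set.Icc (0 : ℝ) 1) (hS : Realizable S μ T)
    {l : ℕ} (hl : l < numSegments μ T) {a : Fin K} (ha : segMean μ T l a < S) :
    gap S μ T l a ≤ 1 ∧
      1 ≤ 1 / gap S μ T l a + gap S μ T l a / (bestGap S μ T l) ^ 2 := by
  have h0 : gap S μ T l a = S - segMean μ T l a := max_eq_right (by linarith)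
  have h1 : 0 < gap S μ T l a := by rw [h0]; linarith
  have h2 : gap S μ T l a ≤ 1 := by
    have h3 : 0 ≤ segMean μ T l a := (hμ _ (changePoint_mem_Icc hT hl) a).1
    have h4 := threshold_lt_one hT hμ hS
    rw [h0]; linarith
  refine ⟨h2, ?_⟩
  have h3 : 1 ≤ 1 / gap S μ T l a := (one_le_div h1).2 h2
  have h4 : 0 ≤ gap S μ T l a / (bestGap S μ T l) ^ 2 := by positivity
  linarith

variable {Ω : Type*} {ξ : ℕ → Ω → Fin K → ℝ}

theorem shortfall_nonneg (π : Policy K) (ω : Ω) : 0 ≤ shortfall S T π μ ξ ω :=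
  Finset.sum_nonneg fun _ _ => le_max_left _ _

theorem shortfall_le [NeZero K] (hT : 1 ≤ T)
    (hμ : ∀ t ∈ Finset.Icc 1 T, ∀ a, μ t a ∈ Set.Icc (0 : ℝ) 1) (hS : Realizable S μ T)
    (π : Policy K) (ω : Ω) : shortfall S T π μ ξ ω ≤ T := by
  have h1 := threshold_lt_one hT hμ hS
  calc shortfall S T π μ ξ ω ≤ ∑ t ∈ Finset.Icc 1 T, (1 : ℝ) :=
        Finset.sum_le_sum fun t ht =>
          max_le zero_le_one (by linarith [(hμ t ht (action π μ ξ t ω)).1])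
    _ = T := by simp

theorem shortfall_eq_zero (hT : 1 ≤ T)
    (h : ∀ l < numSegments μ T, ∀ a, S ≤ segMean μ T l a) (π : Policy K) (ω : Ω) :
    shortfall S T π μ ξ ω = 0 := by
  rw [shortfall, sum_rounds_eq_sum_segments μ hT]
  refine Finset.sum_eq_zero fun l hl => Finset.sum_eq_zero fun t ht => ?_
  rw [Finset.mem_range] at hl
  rw [Finset.mem_Ico] at ht
  rw [eq_segMean μ hT hl ht.1 ht.2]
  exact max_eq_left (by linarith [h l hl (action π μ ξ t ω)])

theorem shortfall_eq_run [NeZero K] (order : Equiv.Perm (Fin K)) (ω : Ω) :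
    shortfall S T (nonstationarySat K T S order) μ ξ ω =
      ∑ t ∈ Finset.Icc 1 T, max 0 (S - μ t ((run S (radius K T) order
        (fun τ a => μ τ a + ξ τ ω a) (t - 1)).arm order)) := by
  refine Finset.sum_congr rfl fun t ht => ?_
  obtain ⟨t, rfl⟩ : ∃ s, t = s + 1 :=
    ⟨t - 1, (Nat.sub_add_cancel (Finset.mem_Icc.1 ht).1).symm⟩
  rw [action_succ, Nat.add_sub_cancel]

variable [MeasurableSpace Ω] {P : Measure Ω}

theorem measurable_table_add (μ : ℕ → Fin K → ℝ) :
    Measurable (fun (z : ℕ → Fin K → ℝ) τ a => μ τ a + z τ a) := by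
  fun_prop

theorem measurable_shortfall [NeZero K] (order : Equiv.Perm (Fin K)) (hξ : IsNoise P ξ) :
    Measurable (shortfall S T (nonstationarySat K T S order) μ ξ) := by
  have hZ : Measurable (fun ω τ => ξ τ ω) := measurable_pi_lambda _ hξ.measurable
  simp only [funext (shortfall_eq_run (S := S) (T := T) (μ := μ) (ξ := ξ) order)]
  refine Finset.measurable_sum _ fun t _ => ?_
  exact (measurable_of_countable (fun a => max 0 (S - μ t a))).comp
    ((measurable_run_arm S (radius K T) order (t - 1)).comp ((measurable_table_add μ).comp hZ))

theorem integrable_shortfall [NeZero K] [IsProbabilityMeasure P] (hT : 1 ≤ T)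
    (hμ : ∀ t ∈ Finset.Icc 1 T, ∀ a, μ t a ∈ Set.Icc (0 : ℝ) 1) (hS : Realizable S μ T)
    (order : Equiv.Perm (Fin K)) (hξ : IsNoise P ξ) :
    Integrable (shortfall S T (nonstationarySat K T S order) μ ξ) P := by
  refine Integrable.of_bound (measurable_shortfall order hξ).aestronglyMeasurable (T : ℝ)
    (Filter.Eventually.of_forall fun ω => ?_)
  rw [Real.norm_of_nonneg (shortfall_nonneg _ ω)]
  exact shortfall_le hT hμ hS _ ω

/-- The regret is at most the bound under concentration plus the contribution of its failure. -/
theorem regret_le_add_two [NeZero K] [IsProbabilityMeasure P] (hT : 1 ≤ T)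
    (hμ : ∀ t ∈ Finset.Icc 1 T, ∀ a, μ t a ∈ Set.Icc (0 : ℝ) 1) (hS : Realizable S μ T)
    (order : Equiv.Perm (Fin K)) (hξ : IsNoise P ξ) :
    regret P S T (nonstationarySat K T S order) μ ξ ≤
      ∑ l ∈ Finset.range (numSegments μ T),
        ∑ a ∈ Finset.univ.filter (fun a => segMean μ T l a < S),
          (16 * (4 * Real.log T + Real.log K) *
            (1 / gap S μ T l a + gap S μ T l a / (bestGap S μ T l) ^ 2) +
              3 * gap S μ T l a) + 2 := by
  set B : ℝ := ∑ l ∈ Finset.range (numSegments μ T),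
        ∑ a ∈ Finset.univ.filter (fun a => segMean μ T l a < S),
          (16 * (4 * Real.log T + Real.log K) *
            (1 / gap S μ T l a + gap S μ T l a / (bestGap S μ T l) ^ 2) +
              3 * gap S μ T l a) with hB
  have hT0 : (0 : ℝ) < T := by exact_mod_cast hT
  have hB0 : 0 ≤ B := by
    refine Finset.sum_nonneg fun l _ => Finset.sum_nonneg fun a _ => ?_
    have h1 : 0 ≤ Real.log T := Real.log_natCast_nonneg T
    have h2 : 0 ≤ Real.log K := Real.log_natCast_nonneg K
    have h3 : 0 ≤ gap S μ T l a := le_max_left _ _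
    positivity
  let α : (ℕ → Fin K → ℝ) → ℕ → Fin K := fun z τ =>
    (run S (radius K T) order (fun t a => μ t a + z t a) τ).arm order
  have hα : ∀ t, Measurable (fun z => α z t) := fun t =>
    (measurable_run_arm S (radius K T) order t).comp (measurable_table_add μ)
  have hα' : ∀ t z z', (∀ τ ≤ t, z τ = z' τ) → α z t = α z' t := fun t z z' h => by
    simp only [α]
    rw [run_congr (y' := fun t a => μ t a + z' t a) fun τ hτ => by simp only [h τ hτ]]
  -- A measurable hull of equal measure replaces the failure event, whose own measurability is then
  -- not needed.
  set N : Set Ω := toMeasurable P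
    {ω | ¬ WellConcentrated T (α (fun τ => ξ τ ω)) (fun τ => ξ τ ω)} with hN
  have hNm : MeasurableSet N := measurableSet_toMeasurable _ _
  have hNP : P.real N ≤ 2 / T := by
    refine ENNReal.toReal_le_of_le_ofReal (by positivity) ?_
    rw [hN, measure_toMeasurable]
    exact measure_not_wellConcentrated_le hT hξ hα hα'
  have hpt : ∀ ω, shortfall S T (nonstationarySat K T S order) μ ξ ω ≤
      B + N.indicator (fun _ => (T : ℝ)) ω := by
    intro ω
    by_cases hω : ω ∈ N
    · rw [Set.indicator_of_mem hω]
      linarith [shortfall_le (ξ := ξ) hT hμ hS (nonstationarySat K T S order) ω]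
    · rw [Set.indicator_of_notMem hω, add_zero, shortfall_eq_run]
      refine run_shortfall_le hT hS (z := fun τ => ξ τ ω) ?_
      by_contra hw
      exact hω (subset_toMeasurable _ _ hw)
  have hi : Integrable (N.indicator fun _ => (T : ℝ)) P := (integrable_const _).indicator hNm
  calc regret P S T (nonstationarySat K T S order) μ ξ
      ≤ ∫ ω, (B + N.indicator (fun _ => (T : ℝ)) ω) ∂P :=
        integral_mono (integrable_shortfall hT hμ hS order hξ)
          ((integrable_const B).add hi) hpt
    _ = B + P.real N * T := by
        rw [integral_add (integrable_const B) hi, integral_const, probReal_univ, one_smul,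
          integral_indicator_const _ hNm, smul_eq_mul]
    _ ≤ B + 2 / T * T := by gcongr
    _ = B + 2 := by rw [div_mul_cancel₀ _ hT0.ne']

end Regret

end SatBandit

theorem theorem3 (c : ℝ) :
    ∃ C : ℝ, 0 < C ∧
      ∀ (K T : ℕ) [NeZero K], 2 ≤ T → (K : ℝ) ≤ c * (T : ℝ) →
      ∀ (S : ℝ) (order : Equiv.Perm (Fin K)) (μ : ℕ → Fin K → ℝ),
        (∀ t ∈ Finset.Icc 1 T, ∀ a, μ t a ∈ Set.Icc (0 : ℝ) 1) →
        SatBandit.Realizable S μ T →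
      ∀ (Ω : Type*) [MeasurableSpace Ω] (P : MeasureTheory.Measure Ω)
        [MeasureTheory.IsProbabilityMeasure P] (ξ : ℕ → Ω → Fin K → ℝ),
        SatBandit.IsNoise P ξ →
        MeasureTheory.Integrable
          (SatBandit.shortfall S T (SatBandit.nonstationarySat K T S order) μ ξ) P ∧
        SatBandit.regret P S T (SatBandit.nonstationarySat K T S order) μ ξ ≤
          C * ((∑ l ∈ Finset.range (SatBandit.numSegments μ T),
            ∑ a ∈ Finset.univ.filter (fun a => SatBandit.segMean μ T l a < S),
              (1 / SatBandit.gap S μ T l a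
                + SatBandit.gap S μ T l a / (SatBandit.bestGap S μ T l) ^ 2)) *
            Real.log T) := by
  -- With `1 ≤ 2 log T`, `log K ≤ log c + log T` is at most `(1 + 2 |log c|) log T`. The 10 is 6 for
  -- the terms `3 * gap` plus 4 for the additive 2.
  refine ⟨16 * (5 + 2 * |Real.log c|) + 10, by positivity, ?_⟩
  intro K T _ hT hKT S order μ hμ hS Ω _ P _ ξ hξ
  have hT1 : 1 ≤ T := by omega
  refine ⟨SatBandit.integrable_shortfall hT1 hμ hS order hξ, ?_⟩
  -- If no arm is ever below `S`, the bound is 0 and cannot absorb an additive 2, but the shortfall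
  -- itself vanishes. Otherwise some summand is at least 1.
  by_cases hbad : ∀ l < SatBandit.numSegments μ T, ∀ a, S ≤ SatBandit.segMean μ T l a
  · have h0 : SatBandit.regret P S T (SatBandit.nonstationarySat K T S order) μ ξ = 0 := by
      rw [SatBandit.regret]
      simp only [SatBandit.shortfall_eq_zero hT1 hbad, integral_zero]
    rw [h0, Finset.sum_eq_zero, zero_mul, mul_zero]
    intro l hl
    rw [Finset.filter_false_of_mem, Finset.sum_empty]
    exact fun a _ => not_lt.2 (hbad l (Finset.mem_range.1 hl) a)
  push Not at hbad
  obtain ⟨l₀, hl₀, a₀, ha₀⟩ := hbad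
  set X : ℕ → Fin K → ℝ := fun l a => 1 / SatBandit.gap S μ T l a
    + SatBandit.gap S μ T l a / (SatBandit.bestGap S μ T l) ^ 2 with hX
  have hX0 : ∀ l a, 0 ≤ X l a := fun l a => by
    have h : 0 ≤ SatBandit.gap S μ T l a := le_max_left _ _
    positivity
  have hT0 : (0 : ℝ) < T := by exact_mod_cast hT1
  have hK1 : (1 : ℝ) ≤ K := by exact_mod_cast Nat.pos_of_ne_zero (NeZero.ne K)
  have hlogT : 1 ≤ 2 * Real.log T := by
    have h1 : Real.log 2 ≤ Real.log T := Real.log_le_log (by norm_num) (by exact_mod_cast hT)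
    linarith [Real.log_two_gt_d9]
  have hc : 0 < c := by
    by_contra hc
    have := mul_nonpos_of_nonpos_of_nonneg (not_lt.1 hc) hT0.le
    linarith
  have hlogK : 4 * Real.log T + Real.log K ≤ (5 + 2 * |Real.log c|) * Real.log T := by
    have h1 : Real.log K ≤ Real.log (c * T) := Real.log_le_log (by linarith) hKT
    rw [Real.log_mul hc.ne' hT0.ne'] at h1
    nlinarith [le_abs_self (Real.log c),
      mul_le_mul_of_nonneg_left hlogT (abs_nonneg (Real.log c))]
  have hsum : 1 ≤ ∑ l ∈ Finset.range (SatBandit.numSegments μ T),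
      ∑ a ∈ Finset.univ.filter (fun a => SatBandit.segMean μ T l a < S), X l a :=
    calc (1 : ℝ) ≤ X l₀ a₀ := (SatBandit.one_le_inv_gap_add hT1 hμ hS hl₀ ha₀).2
      _ ≤ ∑ a ∈ Finset.univ.filter (fun a => SatBandit.segMean μ T l₀ a < S), X l₀ a :=
        Finset.single_le_sum (fun a _ => hX0 l₀ a)
          (Finset.mem_filter.2 ⟨Finset.mem_univ _, ha₀⟩)
      _ ≤ _ := Finset.single_le_sum (f := fun l =>
          ∑ a ∈ Finset.univ.filter (fun a => SatBandit.segMean μ T l a < S), X l a)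
          (fun l _ => Finset.sum_nonneg fun a _ => hX0 l a) (Finset.mem_range.2 hl₀)
  have hmain := SatBandit.regret_le_add_two hT1 hμ hS order hξ
  have hterm : ∑ l ∈ Finset.range (SatBandit.numSegments μ T),
      ∑ a ∈ Finset.univ.filter (fun a => SatBandit.segMean μ T l a < S),
        (16 * (4 * Real.log T + Real.log K) * X l a + 3 * SatBandit.gap S μ T l a) ≤
      (16 * (5 + 2 * |Real.log c|) + 6) * Real.log T *
        ∑ l ∈ Finset.range (SatBandit.numSegments μ T),
          ∑ a ∈ Finset.univ.filter (fun a => SatBandit.segMean μ T l a < S), X l a := by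
    simp only [Finset.mul_sum]
    refine Finset.sum_le_sum fun l hl => Finset.sum_le_sum fun a ha => ?_
    obtain ⟨h1, h2⟩ := SatBandit.one_le_inv_gap_add hT1 hμ hS (Finset.mem_range.1 hl)
      (Finset.mem_filter.1 ha).2
    have h3 := mul_le_mul_of_nonneg_right hlogK (hX0 l a)
    have h4 : (1 : ℝ) ≤ X l a := h2
    have h5 := mul_le_mul_of_nonneg_right hlogT (hX0 l a)
    linarith
  refine hmain.trans ((add_le_add_left hterm 2).trans ?_)
  have h6 := mul_le_mul hlogT hsum zero_le_one (by linarith)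
  linarith

end
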